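/- **Setting.** Let $\mathcal A,\mathcal B$ be finite action sets with $A=|\mathcal A|\ge 2$, $B=|\mathcal B|\ge 2$. When the leader plays $a$ and the follower plays $b$, the pair of rewards $(r_l,r_f)\in[0,1]^2$ is drawn from a fixed law depending on $(a,b)$, with means $\mu_l(a,b),\mu_f(a,b)$. Assume that for every $a$ the best response $\mathcal F_{br}(a)=\arg\max_b\mu_f(a,b)$ is unique and that $a_{se}=\arg\max_a\mu_l(a,\mathcal F_{br}(a))$ is unique; put $b_{se}=\mathcal F_{br}(a_{se})$ and $$\Delta_1=\min_a\min_{b\ne\mathcal F_{br}(a)}\big(\mu_f(a,\mathcal F_{br}(a))-\mu_f(a,b)\big),\qquad \Delta_2=\min_{a\neq a_{se}}\big(\mu_l(a_{se},b_{se})-\mu_l(a,\mathcal F_{br}(a))\big).$$ **Algorithm (EXP3-UCB).** The game is played for $T\ge1$ rounds; let $\delta\in(0,1)$, $\alpha\in(0,1]$, $\eta>0$. In round $t$ the leader draws $a_t$, given the past, from $$\tilde x_t=(1-\alpha)x_t+\alpha\,(1/A,\dots,1/A),\quad x_t(a)=\frac{e^{y_{t-1}(a)}}{\sum_{a'}e^{y_{t-1}(a')}},\quad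 y_t(a)=\sum_{\tau=1}^{t}\eta\,\frac{r_{l,\tau}\,\mathbb I\{a_\tau=a\}}{\tilde x_\tau(a)},\quad y_0=0.$$ The follower sees $a_t$ and plays any maximizer $b_t$ over $b$ of $\hat\mu_{f,t}(a_t,b)+\sqrt{2\log(T/\delta)/n_t(a_t,b)}$, where $n_t(a,b)=\max\{1,\sum_{\tau<t}\mathbb I\{a_\tau=a,b_\tau=b\}\}$ and $\hat\mu_{f,t}(a,b)=\frac1{n_t(a,b)}\sum_{\tau<t}r_{f,\tau}\mathbb I\{a_\tau=a,b_\tau=b\}$. Given the past and $(a_t,b_t)$, the rewards $(r_{l,t},r_{f,t})$ have the law attached to $(a_t,b_t)$; the leader observes $r_{l,t}$ and the follower observes $r_{f,t}$ only (limited information). **Theorem.** (i) There is an absolute constant $C_1>0$ such that the following holds for every such game and every $T$ and $\delta$. Let $\alpha=c_\alpha T^{-1/3}\le1$ and $\eta=c_\eta T^{-1/3}$ with $c_\alpha\ge1$, $c_\eta\ge1$, and assume that $c_\alpha\ge1+\log A$ or $\delta\le T^{-3}$. Then, with probability at least $1-3\delta$ over the first $T-1$ rounds, the conditional probability given these rounds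 satisfies $$\mathbb P\big[a_T\ne a_{se}\,\big|\,\text{rounds }1,\dots,T-1\big]\le\alpha+A\exp\!\Big(-\Delta_2T^{2/3}+2\sqrt{2A\log\tfrac2\delta}\;T^{1/3}+\frac{C_1AB}{\Delta_1^2}\log\frac T\delta\,\log\frac1\delta\Big).$$ (ii) (Last-iterate convergence.) For every such game and all $c_\alpha,c_\eta,\beta>0$, if $\alpha=c_\alpha T^{-1/3}$, $\eta=c_\eta T^{-1/3}$ and $T^{-\beta}\le\delta<1$, then $\mathbb P[a_T\ne a_{se}]\to0$ as $T\to\infty$, uniformly over such $\delta$ and over the tie-breaking of the follower. -/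

import Mathlib

open MeasureTheory ProbabilityTheory

noncomputable section

namespace StackelbergLearning

/-- A general-sum Stackelberg game with noisy rewards: when the leader plays `a` and the follower
plays `b`, the pair (leader's reward, follower's reward) has law `reward a b` on `[0,1] × [0,1]`.
No independence between the two coordinates is required. -/
structure Game (𝓐 𝓑 : Type*) where
  reward : 𝓐 → 𝓑 → Measure (ℝ × ℝ)
  isProbabilityMeasure : ∀ a b, IsProbabilityMeasure (reward a b)
  mem_unit : ∀ a b, ∀ᵐ r ∂(reward a b), r.1 ∈ Set.Icc (0 : ℝ) 1 ∧ r.2 ∈ Set.Icc (0 : ℝ) 1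

namespace Game

variable {𝓐 𝓑 : Type*} (G : Game 𝓐 𝓑)

/-- Mean reward of the leader. -/
def meanL (a : 𝓐) (b : 𝓑) : ℝ := ∫ r, r.1 ∂(G.reward a b)

/-- Mean reward of the follower. -/
def meanF (a : 𝓐) (b : 𝓑) : ℝ := ∫ r, r.2 ∂(G.reward a b)

/-- `br a` is the unique maximizer of the follower's mean reward against `a`, for every `a`. -/
def IsUniqueBestResponse (br : 𝓐 → 𝓑) : Prop :=
  ∀ a b, (∀ b', G.meanF a b' ≤ G.meanF a b) ↔ b = br a

/-- `(ase, br ase)` is the unique Stackelberg equilibrium: `ase` is the unique maximizer of the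
leader's mean reward under best responses. -/
def IsUniqueStackelberg (br : 𝓐 → 𝓑) (ase : 𝓐) : Prop :=
  ∀ a, (∀ a', G.meanL a' (br a') ≤ G.meanL a (br a)) ↔ a = ase

/-- The follower's gap `Δ₁ = min_a min_{b ≠ br a} (μ_f(a, br a) - μ_f(a, b))`. -/
def gapF (br : 𝓐 → 𝓑) : ℝ :=
  ⨅ p : {p : 𝓐 × 𝓑 // p.2 ≠ br p.1}, (G.meanF p.1.1 (br p.1.1) - G.meanF p.1.1 p.1.2)

/-- The leader's gap `Δ₂ = min_{a ≠ ase} (μ_l(ase, br ase) - μ_l(a, br a))`. -/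
def gapL (br : 𝓐 → 𝓑) (ase : 𝓐) : ℝ :=
  ⨅ a : {a : 𝓐 // a ≠ ase}, (G.meanL ase (br ase) - G.meanL a.1 (br a.1))

end Game

/-- What happens in one round: the leader's action, the follower's action, the leader's reward and
the follower's reward. -/
abbrev Round (𝓐 𝓑 : Type*) := 𝓐 × 𝓑 × ℝ × ℝ

section Round

variable {𝓐 𝓑 : Type*}

def actL (q : Round 𝓐 𝓑) : 𝓐 := q.1
def actF (q : Round 𝓐 𝓑) : 𝓑 := q.2.1
def rewL (q : Round 𝓐 𝓑) : ℝ := q.2.2.1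
def rewF (q : Round 𝓐 𝓑) : ℝ := q.2.2.2

end Round

section Leader

variable {𝓐 𝓑 : Type*} [Fintype 𝓐] [DecidableEq 𝓐]

/-- The exponential weights with scores `y`. -/
def softmax (y : 𝓐 → ℝ) (a : 𝓐) : ℝ := Real.exp (y a) / ∑ a', Real.exp (y a')

/-- Exponential weights mixed with uniform exploration of rate `α`. -/
def mixed (α : ℝ) (y : 𝓐 → ℝ) (a : 𝓐) : ℝ :=
  (1 - α) * softmax y a + α * (1 / (Fintype.card 𝓐 : ℝ))

/-- The scores `y_t(a) = ∑_{τ = 1}^{t} η r̃_τ(a)` along a play `q` (rounds are numbered `1, 2, …`;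
`q 0` is never used), with the importance-weighted estimate
`r̃_τ(a) = 𝟙{a_τ = a} r_{l,τ} / x̃_τ(a)`, where `x̃_τ = mixed α y_{τ-1}`. -/
def score (α η : ℝ) (q : ℕ → Round 𝓐 𝓑) : ℕ → 𝓐 → ℝ
  | 0 => fun _ => 0
  | t + 1 => fun a => score α η q t a +
      η * (if actL (q (t + 1)) = a then rewL (q (t + 1)) / mixed α (score α η q t) a else 0)

/-- The distribution `x̃_t` from which the EXP3 leader draws its action in round `t ≥ 1`. -/
def exp3 (α η : ℝ) (q : ℕ → Round 𝓐 𝓑) (t : ℕ) : 𝓐 → ℝ := mixed α (score α η q (t - 1))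

end Leader

section Follower

variable {𝓐 𝓑 : Type*} [DecidableEq 𝓐] [DecidableEq 𝓑]

/-- `n_t(a,b)`: how often `(a,b)` was played in rounds `1, …, t-1`, but at least `1`. -/
def visits (q : ℕ → Round 𝓐 𝓑) (t : ℕ) (a : 𝓐) (b : 𝓑) : ℝ :=
  max 1 (∑ τ ∈ Finset.Ico 1 t, if actL (q τ) = a ∧ actF (q τ) = b then (1 : ℝ) else 0)

/-- The empirical mean of the follower's reward for `(a,b)` over rounds `1, …, t-1`. -/
def empF (q : ℕ → Round 𝓐 𝓑) (t : ℕ) (a : 𝓐) (b : 𝓑) : ℝ :=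
  (1 / visits q t a b) *
    ∑ τ ∈ Finset.Ico 1 t, if actL (q τ) = a ∧ actF (q τ) = b then rewF (q τ) else 0

/-- The follower's upper confidence bound with horizon `T` and confidence parameter `δ`. -/
def ucbF (T : ℕ) (δ : ℝ) (q : ℕ → Round 𝓐 𝓑) (t : ℕ) (a : 𝓐) (b : 𝓑) : ℝ :=
  empF q t a b + Real.sqrt (2 * Real.log (T / δ) / visits q t a b)

end Follower

section Run

variable {𝓐 𝓑 Ω : Type*} [MeasurableSpace 𝓐] [MeasurableSpace 𝓑]

/-- The information generated by rounds `1, …, t-1`. -/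
@[reducible] def past (h : ℕ → Ω → Round 𝓐 𝓑) (t : ℕ) : MeasurableSpace Ω :=
  ⨆ τ ∈ Set.Ico 1 t, MeasurableSpace.comap (h τ) inferInstance

/-- The information generated by rounds `1, …, t-1` and both actions of round `t`. -/
@[reducible] def pastAndActions (h : ℕ → Ω → Round 𝓐 𝓑) (t : ℕ) : MeasurableSpace Ω :=
  past h t ⊔ MeasurableSpace.comap (fun ω => (actL (h t ω), actF (h t ω))) inferInstance

/-- The process `h` on the probability space `(Ω, P)` is a `T`-round play of `G` in the
limited-information setting in which the leader runs EXP3 with exploration rate `α` and learning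
rate `η`, and the follower runs UCB separately for every leader action. Ties between maximal
upper confidence bounds may be broken in any way. -/
structure IsEXP3UCBRun [Fintype 𝓐] [DecidableEq 𝓐] [DecidableEq 𝓑] [MeasurableSpace Ω]
    (G : Game 𝓐 𝓑) (T : ℕ) (δ α η : ℝ) (P : Measure Ω) (h : ℕ → Ω → Round 𝓐 𝓑) : Prop where
  measurable : ∀ t ∈ Set.Icc 1 T, Measurable (h t)
  /-- given the past, the leader's action has law `x̃_t` -/
  leader : ∀ t ∈ Set.Icc 1 T, ∀ a : 𝓐,
    P⟦{ω | actL (h t ω) = a} | past h t⟧ =ᵐ[P] fun ω => exp3 α η (fun τ => h τ ω) t a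
  /-- having seen the leader's action, the follower maximizes its upper confidence bound -/
  follower : ∀ t ∈ Set.Icc 1 T, ∀ᵐ ω ∂P, ∀ b : 𝓑,
    ucbF T δ (fun τ => h τ ω) t (actL (h t ω)) b
      ≤ ucbF T δ (fun τ => h τ ω) t (actL (h t ω)) (actF (h t ω))
  /-- given the past and the two actions, the rewards are drawn from the law of the action pair -/
  rewards : ∀ t ∈ Set.Icc 1 T, ∀ s : Set (ℝ × ℝ), MeasurableSet s →
    P⟦{ω | (rewL (h t ω), rewF (h t ω)) ∈ s} | pastAndActions h t⟧
      =ᵐ[P] fun ω => (G.reward (actL (h t ω)) (actF (h t ω))).real s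

end Run

end StackelbergLearning

end

/-!
Since `x̃_t ≥ α / A`, the importance-weighted estimates of the leader are bounded by `A / α`.
Replace the leader's reward by its mean under the best response whenever the follower deviates from
it: the difference of the estimates of a suboptimal action and of `ase` then has conditional mean at
most `-Δ₂`, and an exponential supermartingale (Freedman-type) bound controls its fluctuation. The
price of the replacement is `A / α` for every round with a wrong response. Wrong responses are rare
by the usual UCB argument: on the event that all empirical means are close to the true means, a
wrong response can be played at most `O(log (T / δ) / Δ₁²)` times. As the follower's sample sizes
are random, this event is controlled by a union bound over the number of plays of each action pair.
Hence the score of `ase` leads all others by `η` times a quantity of order `Δ₂ T` at time `T - 1`,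
and softmax turns the lead into an exponentially small probability.
-/

noncomputable section

namespace StackelbergLearning

section ExponentialMoments

lemma exp_le_one_add_add_sq {x : ℝ} (hx : |x| ≤ 1) : Real.exp x ≤ 1 + x + 3 / 4 * x ^ 2 := by
  have hbound := (abs_le.1 (Real.exp_bound hx (n := 2) (by norm_num))).2
  simp only [Finset.sum_range_succ, Finset.range_one, Finset.sum_singleton, Nat.factorial, sq_abs]
    at hbound
  norm_num at hbound
  linarith

variable {Ω : Type*} {𝓖 mΩ : MeasurableSpace Ω} {P : Measure Ω}

lemma integrable_exp_sum [IsFiniteMeasure P] {ι : Type*} {s : Finset ι} {X : ι → Ω → ℝ} {C : ℝ}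
    (hX : ∀ i ∈ s, AEMeasurable (X i) P) (hC : ∀ i ∈ s, ∀ᵐ ω ∂P, |X i ω| ≤ C) :
    Integrable (fun ω => Real.exp (∑ i ∈ s, X i ω)) P := by
  refine Integrable.of_bound (Finset.aemeasurable_fun_sum s hX).exp.aestronglyMeasurable
    (Real.exp (∑ _i ∈ s, C)) ?_
  filter_upwards [(Filter.eventually_all_finset s).2 hC] with ω hω
  rw [Real.norm_eq_abs, Real.abs_exp]
  exact Real.exp_le_exp.2 (Finset.sum_le_sum fun i hi => (le_abs_self _).trans (hω i hi))

variable [IsProbabilityMeasure P] {𝓕 : ℕ → MeasurableSpace Ω} {X : ℕ → Ω → ℝ} {C : ℝ} {m n : ℕ}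

lemma integral_exp_sum_le_one (h𝓕 : ∀ t ∈ Finset.Ico m n, 𝓕 t ≤ mΩ)
    (hpast : ∀ t ∈ Finset.Ico m n, ∀ s ∈ Finset.Ico m t, Measurable[𝓕 t] (X s))
    (hX : ∀ t ∈ Finset.Ico m n, AEMeasurable (X t) P)
    (hC : ∀ t ∈ Finset.Ico m n, ∀ᵐ ω ∂P, |X t ω| ≤ C)
    (hstep : ∀ t ∈ Finset.Ico m n, P[fun ω => Real.exp (X t ω) | 𝓕 t] ≤ᵐ[P] 1) :
    ∫ ω, Real.exp (∑ t ∈ Finset.Ico m n, X t ω) ∂P ≤ 1 := by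
  rcases lt_or_ge n m with hnm | hmn
  · simp [Finset.Ico_eq_empty_of_le hnm.le]
  induction n, hmn using Nat.le_induction with
  | base => simp
  | succ n hmn ih =>
    have hsub : Finset.Ico m n ⊆ Finset.Ico m (n + 1) := Finset.Ico_subset_Ico_right n.le_succ
    have hn : n ∈ Finset.Ico m (n + 1) := Finset.mem_Ico.2 ⟨hmn, n.lt_succ_self⟩
    set S : Ω → ℝ := fun ω => Real.exp (∑ t ∈ Finset.Ico m n, X t ω)
    set E : Ω → ℝ := fun ω => Real.exp (X n ω)
    have hsplit : (fun ω => Real.exp (∑ t ∈ Finset.Ico m (n + 1), X t ω)) = S * E := by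
      funext ω
      rw [Finset.sum_Ico_succ_top hmn, Real.exp_add, Pi.mul_apply]
    have hSmeas : Measurable[𝓕 n] S := by
      let := 𝓕 n
      exact Real.measurable_exp.comp (Finset.measurable_sum _ (hpast n hn))
    have hSint : Integrable S P :=
      integrable_exp_sum (fun t ht => hX t (hsub ht)) fun t ht => hC t (hsub ht)
    have hEint : Integrable E P := by
      simpa using integrable_exp_sum (s := {n}) (C := C) (by simpa using hX n hn)
        (by simpa using hC n hn)
    have hSEint : Integrable (S * E) P := hsplit ▸ integrable_exp_sum hX hC
    have hpull : P[S * E | 𝓕 n] ≤ᵐ[P] S := by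
      filter_upwards [condExp_mul_of_stronglyMeasurable_left hSmeas.stronglyMeasurable hSEint hEint,
        hstep n hn] with ω hω hle
      rw [hω]
      exact mul_le_of_le_one_right (Real.exp_pos _).le hle
    rw [hsplit, ← integral_condExp (h𝓕 n hn)]
    exact (integral_mono_ae integrable_condExp hSint hpull).trans
      (ih (fun t ht => h𝓕 t (hsub ht)) (fun t ht => hpast t (hsub ht))
        (fun t ht => hX t (hsub ht)) (fun t ht => hC t (hsub ht)) fun t ht => hstep t (hsub ht))

lemma measureReal_le_sum_le_exp_neg (h𝓕 : ∀ t ∈ Finset.Ico m n, 𝓕 t ≤ mΩ)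
    (hpast : ∀ t ∈ Finset.Ico m n, ∀ s ∈ Finset.Ico m t, Measurable[𝓕 t] (X s))
    (hX : ∀ t ∈ Finset.Ico m n, AEMeasurable (X t) P)
    (hC : ∀ t ∈ Finset.Ico m n, ∀ᵐ ω ∂P, |X t ω| ≤ C)
    (hstep : ∀ t ∈ Finset.Ico m n, P[fun ω => Real.exp (X t ω) | 𝓕 t] ≤ᵐ[P] 1) (u : ℝ) :
    P.real {ω | u ≤ ∑ t ∈ Finset.Ico m n, X t ω} ≤ Real.exp (-u) := by
  have hchernoff := measure_ge_le_exp_mul_mgf (μ := P) u zero_le_one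
    (X := fun ω => ∑ t ∈ Finset.Ico m n, X t ω) (by simpa using integrable_exp_sum hX hC)
  refine hchernoff.trans ?_
  have hmgf : mgf (fun ω => ∑ t ∈ Finset.Ico m n, X t ω) P 1 ≤ 1 := by
    simpa only [mgf, one_mul] using integral_exp_sum_le_one h𝓕 hpast hX hC hstep
  simpa using mul_le_of_le_one_right (Real.exp_pos (-1 * u)).le hmgf

-- Thanks to `(X - Y)² ≤ R (X + Y)`, the means alone control the second moment.
lemma condExp_exp_mul_sub_le_one (h𝓖 : 𝓖 ≤ mΩ) {X Y : Ω → ℝ}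
    {R x y l : ℝ} (hX : AEMeasurable X P) (hY : AEMeasurable Y P)
    (hXR : ∀ᵐ ω ∂P, X ω ∈ Set.Icc 0 R) (hYR : ∀ᵐ ω ∂P, Y ω ∈ Set.Icc 0 R)
    (hXmean : P[X | 𝓖] =ᵐ[P] fun _ => x) (hYmean : P[Y | 𝓖] =ᵐ[P] fun _ => y)
    (hl : 0 ≤ l) (hlR : l * R ≤ 1) :
    P[fun ω => Real.exp (l * (X ω - Y ω) - (l * (x - y) + 3 / 4 * l ^ 2 * R * (x + y))) | 𝓖]
      ≤ᵐ[P] 1 := by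
  set k := 3 / 4 * l ^ 2 * R with hk
  set e := Real.exp (-(l * (x - y) + k * (x + y))) with he
  set g : Ω → ℝ := fun ω => e * (1 + ((l + k) * X ω + (k - l) * Y ω))
  have hXint : Integrable X P := Integrable.of_mem_Icc 0 R hX hXR
  have hYint : Integrable Y P := Integrable.of_mem_Icc 0 R hY hYR
  have hlin : Integrable ((l + k) • X + (k - l) • Y) P := (hXint.smul _).add (hYint.smul _)
  have hgint : Integrable g P := ((integrable_const (1 : ℝ)).add hlin).const_mul e
  have hpoint : ∀ᵐ ω ∂P, Real.exp (l * (X ω - Y ω) - (l * (x - y) + k * (x + y))) ≤ g ω := by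
    filter_upwards [hXR, hYR] with ω ⟨hX0, hX1⟩ ⟨hY0, hY1⟩
    have hR : |l * (X ω - Y ω)| ≤ 1 := by
      rw [abs_mul, abs_of_nonneg hl]
      exact (mul_le_mul_of_nonneg_left (abs_sub_le_iff.2 ⟨by linarith, by linarith⟩) hl).trans hlR
    have hsq : (X ω - Y ω) ^ 2 ≤ R * (X ω + Y ω) := by
      nlinarith [mul_nonneg hX0 (sub_nonneg.2 hX1), mul_nonneg hY0 (sub_nonneg.2 hY1),
        mul_nonneg hX0 hY0]
    have hexp := exp_le_one_add_add_sq hR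
    have hquad := mul_le_mul_of_nonneg_left hsq (by positivity : 0 ≤ 3 / 4 * l ^ 2)
    rw [sub_eq_add_neg, Real.exp_add, mul_comm]
    exact mul_le_mul_of_nonneg_left (by rw [hk]; linarith) (Real.exp_pos _).le
  have hexpint : Integrable
      (fun ω => Real.exp (l * (X ω - Y ω) - (l * (x - y) + k * (x + y)))) P :=
    hgint.mono' (((hX.sub hY).const_mul l).sub_const _).exp.aestronglyMeasurable
      (by simpa only [Real.norm_eq_abs, Real.abs_exp] using hpoint)
  have hgmean : P[g | 𝓖] =ᵐ[P] fun _ => e * (1 + ((l + k) * x + (k - l) * y)) := by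
    filter_upwards [condExp_smul e ((fun _ => (1 : ℝ)) + ((l + k) • X + (k - l) • Y)) 𝓖 (μ := P),
      condExp_add (integrable_const (1 : ℝ)) hlin 𝓖,
      condExp_add (hXint.smul (l + k)) (hYint.smul (k - l)) 𝓖, condExp_smul (l + k) X 𝓖 (μ := P),
      condExp_smul (k - l) Y 𝓖 (μ := P), hXmean, hYmean] with ω h₁ h₂ h₃ h₄ h₅ hx hy
    refine h₁.trans ?_
    simp only [Pi.smul_apply, smul_eq_mul, h₂, Pi.add_apply, condExp_const h𝓖, h₃, h₄, h₅, hx, hy]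
  filter_upwards [condExp_mono (m := 𝓖) hexpint hgint hpoint, hgmean] with ω hω hgω
  refine (hω.trans_eq hgω).trans ?_
  rw [he, Real.exp_neg, Pi.one_apply, inv_mul_le_iff₀ (Real.exp_pos _), mul_one]
  linarith [Real.add_one_le_exp (l * (x - y) + k * (x + y))]

lemma measureReal_le_sum_sub_le_exp_neg {Y : ℕ → Ω → ℝ} {R x y l : ℝ}
    (h𝓕 : ∀ t ∈ Finset.Ico m n, 𝓕 t ≤ mΩ)
    (hXpast : ∀ t ∈ Finset.Ico m n, ∀ s ∈ Finset.Ico m t, Measurable[𝓕 t] (X s))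
    (hYpast : ∀ t ∈ Finset.Ico m n, ∀ s ∈ Finset.Ico m t, Measurable[𝓕 t] (Y s))
    (hX : ∀ t ∈ Finset.Ico m n, AEMeasurable (X t) P)
    (hY : ∀ t ∈ Finset.Ico m n, AEMeasurable (Y t) P)
    (hXR : ∀ t ∈ Finset.Ico m n, ∀ᵐ ω ∂P, X t ω ∈ Set.Icc 0 R)
    (hYR : ∀ t ∈ Finset.Ico m n, ∀ᵐ ω ∂P, Y t ω ∈ Set.Icc 0 R)
    (hXmean : ∀ t ∈ Finset.Ico m n, P[X t | 𝓕 t] =ᵐ[P] fun _ => x)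
    (hYmean : ∀ t ∈ Finset.Ico m n, P[Y t | 𝓕 t] =ᵐ[P] fun _ => y)
    (hl : 0 < l) (hlR : l * R ≤ 1) (u : ℝ) :
    P.real {ω | (Finset.Ico m n).card * (x - y + 3 / 4 * l * R * (x + y)) + u / l
      ≤ ∑ t ∈ Finset.Ico m n, (X t ω - Y t ω)} ≤ Real.exp (-u) := by
  set k := l * (x - y) + 3 / 4 * l ^ 2 * R * (x + y) with hk
  refine (measureReal_mono fun ω hω => ?_).trans
    (measureReal_le_sum_le_exp_neg (X := fun t ω => l * (X t ω - Y t ω) - k) (C := l * R + |k|) h𝓕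
      (fun t ht s hs => (((hXpast t ht s hs).sub (hYpast t ht s hs)).const_mul l).sub_const k)
      (fun t ht => (((hX t ht).sub (hY t ht)).const_mul l).sub_const k) (fun t ht => ?_)
      (fun t ht => condExp_exp_mul_sub_le_one (h𝓕 t ht) (hX t ht) (hY t ht) (hXR t ht) (hYR t ht)
        (hXmean t ht) (hYmean t ht) hl.le hlR) u)
  · have hscaled := mul_le_mul_of_nonneg_left (Set.mem_ofPred_eq ▸ hω) hl.le
    rw [mul_add, mul_div_cancel₀ u hl.ne'] at hscaled
    rw [Set.mem_ofPred_eq, Finset.sum_sub_distrib, ← Finset.mul_sum, Finset.sum_const, nsmul_eq_mul,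
      hk]
    linarith
  · filter_upwards [hXR t ht, hYR t ht] with ω ⟨hX0, hX1⟩ ⟨hY0, hY1⟩
    refine (abs_sub _ _).trans (add_le_add_left ?_ _)
    rw [abs_mul, abs_of_pos hl]
    exact mul_le_mul_of_nonneg_left (abs_sub_le_iff.2 ⟨by linarith, by linarith⟩) hl.le

lemma measureReal_le_add_measureReal_lt_condExp (h𝓖 : 𝓖 ≤ mΩ) {s : Set Ω}
    (hs : MeasurableSet s) {c : ℝ} (hc : 0 ≤ c) :
    P.real s ≤ c + P.real {ω | c < (P⟦s | 𝓖⟧) ω} := by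
  have hint : Integrable (s.indicator fun _ => (1 : ℝ)) P := (integrable_const 1).indicator hs
  have hle : P⟦s | 𝓖⟧ ≤ᵐ[P] 1 := by
    have := condExp_mono (m := 𝓖) hint (integrable_const (1 : ℝ))
      (Filter.Eventually.of_forall (Set.indicator_le_self' fun _ _ => zero_le_one))
    rwa [condExp_const h𝓖] at this
  set B := {ω | c < (P⟦s | 𝓖⟧) ω}
  have hBmeas : MeasurableSet B :=
    h𝓖 _ (measurableSet_lt measurable_const stronglyMeasurable_condExp.measurable)
  have hBint : Integrable (B.indicator (1 : Ω → ℝ)) P := (integrable_const 1).indicator hBmeas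
  have hsplit : P⟦s | 𝓖⟧ ≤ᵐ[P] fun ω => c + B.indicator 1 ω := by
    filter_upwards [hle] with ω hω
    by_cases hωB : ω ∈ B
    · rw [Set.indicator_of_mem hωB]
      exact hω.trans (le_add_of_nonneg_left hc)
    · rw [Set.indicator_of_notMem hωB, add_zero]
      exact not_lt.1 hωB
  calc P.real s = ∫ ω, (P⟦s | 𝓖⟧) ω ∂P := by
        rw [integral_condExp h𝓖]
        exact (integral_indicator_one hs).symm
    _ ≤ ∫ ω, c + B.indicator 1 ω ∂P :=
        integral_mono_ae integrable_condExp ((integrable_const c).add hBint) hsplit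
    _ = c + P.real B := by
        rw [integral_add (integrable_const c) hBint, integral_indicator_one hBmeas, integral_const,
          probReal_univ, one_smul]

end ExponentialMoments

section Weights

variable {𝓐 : Type*} [Fintype 𝓐]

lemma softmax_nonneg (y : 𝓐 → ℝ) (a : 𝓐) : 0 ≤ softmax y a :=
  div_nonneg (Real.exp_pos _).le (Finset.sum_nonneg fun _ _ => (Real.exp_pos _).le)

lemma softmax_le_one (y : 𝓐 → ℝ) (a : 𝓐) : softmax y a ≤ 1 :=
  div_le_one_of_le₀
    (Finset.single_le_sum (f := fun a' => Real.exp (y a')) (fun _ _ => (Real.exp_pos _).le)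
      (Finset.mem_univ a))
    (Finset.sum_nonneg fun _ _ => (Real.exp_pos _).le)

lemma one_sub_softmax_le (y : 𝓐 → ℝ) (a₀ : 𝓐) {u : ℝ} (hu : ∀ a, a ≠ a₀ → y a - y a₀ ≤ u) :
    1 - softmax y a₀ ≤ Fintype.card 𝓐 * Real.exp u := by
  classical
  set S := ∑ a, Real.exp (y a)
  have hle : Real.exp (y a₀) ≤ S :=
    Finset.single_le_sum (f := fun a => Real.exp (y a)) (fun _ _ => (Real.exp_pos _).le)
      (Finset.mem_univ a₀)
  have hS : 0 < S := (Real.exp_pos _).trans_le hle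
  rw [softmax, one_sub_div hS.ne', div_le_iff₀ hS, ← Finset.sum_erase_eq_sub (Finset.mem_univ a₀)]
  calc ∑ a ∈ Finset.univ.erase a₀, Real.exp (y a)
      ≤ ∑ _a ∈ Finset.univ.erase a₀, Real.exp u * Real.exp (y a₀) := by
        refine Finset.sum_le_sum fun a ha => ?_
        rw [← Real.exp_add]
        exact Real.exp_le_exp.2 (by linarith [hu a (Finset.ne_of_mem_erase ha)])
    _ ≤ Fintype.card 𝓐 * (Real.exp u * Real.exp (y a₀)) := by
        rw [Finset.sum_const, nsmul_eq_mul]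
        gcongr
        exact Finset.card_le_univ _
    _ ≤ Fintype.card 𝓐 * Real.exp u * S := by
        rw [mul_assoc]
        gcongr

variable {α : ℝ}

lemma le_mixed (hα : α ≤ 1) (y : 𝓐 → ℝ) (a : 𝓐) : α / Fintype.card 𝓐 ≤ mixed α y a := by
  rw [mixed, mul_one_div]
  exact le_add_of_nonneg_left (mul_nonneg (sub_nonneg.2 hα) (softmax_nonneg y a))

lemma one_sub_mixed_le (hα₀ : 0 ≤ α) (y : 𝓐 → ℝ) (a₀ : 𝓐) {u : ℝ}
    (hu : ∀ a, a ≠ a₀ → y a - y a₀ ≤ u) :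
    1 - mixed α y a₀ ≤ α + Fintype.card 𝓐 * Real.exp u := by
  have huniform : 0 ≤ α * (1 / (Fintype.card 𝓐 : ℝ)) := by positivity
  have hscaled := mul_le_mul_of_nonneg_left (softmax_le_one y a₀) hα₀
  rw [mixed]
  linarith [one_sub_softmax_le y a₀ hu]

lemma measurable_mixed (α : ℝ) (a : 𝓐) : Measurable fun y : 𝓐 → ℝ => mixed α y a := by
  unfold mixed softmax
  fun_prop

variable [Nonempty 𝓐]

lemma mixed_pos (hα₀ : 0 < α) (hα : α ≤ 1) (y : 𝓐 → ℝ) (a : 𝓐) : 0 < mixed α y a :=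
  (div_pos hα₀ (Nat.cast_pos.2 Fintype.card_pos)).trans_le (le_mixed hα y a)

lemma inv_mixed_le (hα₀ : 0 < α) (hα : α ≤ 1) (y : 𝓐 → ℝ) (a : 𝓐) :
    (mixed α y a)⁻¹ ≤ Fintype.card 𝓐 / α := by
  rw [← inv_div]
  exact inv_anti₀ (div_pos hα₀ (Nat.cast_pos.2 Fintype.card_pos)) (le_mixed hα y a)

end Weights

section Measurability

variable {𝓐 𝓑 Ω : Type*} [MeasurableSpace 𝓐] [MeasurableSpace 𝓑]

@[fun_prop]
lemma measurable_actL : Measurable (actL : Round 𝓐 𝓑 → 𝓐) := measurable_fst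

@[fun_prop]
lemma measurable_actF : Measurable (actF : Round 𝓐 𝓑 → 𝓑) := measurable_fst.comp measurable_snd

@[fun_prop]
lemma measurable_rewL : Measurable (rewL : Round 𝓐 𝓑 → ℝ) :=
  measurable_fst.comp (measurable_snd.comp measurable_snd)

@[fun_prop]
lemma measurable_rewF : Measurable (rewF : Round 𝓐 𝓑 → ℝ) :=
  measurable_snd.comp (measurable_snd.comp measurable_snd)

variable {h : ℕ → Ω → Round 𝓐 𝓑}

lemma measurable_past {τ t : ℕ} (hτ : τ ∈ Set.Ico 1 t) : Measurable[past h t] (h τ) :=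
  (comap_measurable (h τ)).mono
    (le_iSup₂ (f := fun τ (_ : τ ∈ Set.Ico 1 t) => MeasurableSpace.comap (h τ) inferInstance) τ hτ)
    le_rfl

lemma measurable_actions (h : ℕ → Ω → Round 𝓐 𝓑) (t : ℕ) :
    Measurable[pastAndActions h t] fun ω => (actL (h t ω), actF (h t ω)) :=
  (comap_measurable _).mono le_sup_right le_rfl

variable [DiscreteMeasurableSpace 𝓐]

lemma measurableSet_actions_eq [DiscreteMeasurableSpace 𝓑] (h : ℕ → Ω → Round 𝓐 𝓑) (t : ℕ)
    (a : 𝓐) (b : 𝓑) :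
    MeasurableSet[pastAndActions h t] {ω | actL (h t ω) = a ∧ actF (h t ω) = b} := by
  simpa only [Set.preimage, Set.mem_singleton_iff, Prod.mk.injEq]
    using measurable_actions h t (measurableSet_singleton (a, b))

variable [Fintype 𝓐] [DecidableEq 𝓐]

lemma measurable_score [MeasurableSpace Ω] (α η : ℝ) {s : ℕ}
    (hh : ∀ τ ∈ Set.Icc 1 s, Measurable (h τ)) (a : 𝓐) :
    Measurable fun ω => score α η (fun τ => h τ ω) s a := by
  induction s generalizing a with
  | zero => exact measurable_const
  | succ s ih =>
    have hscore := ih fun τ hτ => hh τ ⟨hτ.1, hτ.2.trans s.le_succ⟩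
    have hround := hh (s + 1) ⟨s.succ_pos, le_rfl⟩
    refine (hscore a).add (measurable_const.mul (Measurable.ite ?_ ?_ measurable_const))
    · exact (measurable_actL.comp hround) (measurableSet_singleton a)
    · exact (measurable_rewL.comp hround).div
        ((measurable_mixed α a).comp (measurable_pi_lambda _ hscore))

lemma measurable_exp3 (h : ℕ → Ω → Round 𝓐 𝓑) (α η : ℝ) {t : ℕ} (ht : 1 ≤ t) (a : 𝓐) :
    Measurable[past h t] fun ω => exp3 α η (fun τ => h τ ω) t a := by
  let := past h t
  exact (measurable_mixed α a).comp (measurable_pi_lambda _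
    (measurable_score α η fun τ hτ => measurable_past ⟨hτ.1, by have := hτ.2; omega⟩))

end Measurability

section Conditioning

namespace Game

variable {𝓐 𝓑 : Type*} (G : Game 𝓐 𝓑)

lemma meanL_mem_unit (a : 𝓐) (b : 𝓑) : G.meanL a b ∈ Set.Icc (0 : ℝ) 1 := by
  have := G.isProbabilityMeasure a b
  have hunit := (G.mem_unit a b).mono fun r hr => hr.1
  exact (convex_Icc 0 1).integral_mem isClosed_Icc hunit
    (Integrable.of_mem_Icc 0 1 measurable_fst.aemeasurable hunit)

lemma meanF_mem_unit (a : 𝓐) (b : 𝓑) : G.meanF a b ∈ Set.Icc (0 : ℝ) 1 := by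
  have := G.isProbabilityMeasure a b
  have hunit := (G.mem_unit a b).mono fun r hr => hr.2
  exact (convex_Icc 0 1).integral_mem isClosed_Icc hunit
    (Integrable.of_mem_Icc 0 1 measurable_snd.aemeasurable hunit)

end Game

namespace IsEXP3UCBRun

variable {𝓐 𝓑 Ω : Type*} [Fintype 𝓐] [DecidableEq 𝓐] [MeasurableSpace 𝓐] [DecidableEq 𝓑]
  [MeasurableSpace 𝓑] [mΩ : MeasurableSpace Ω] {G : Game 𝓐 𝓑} {T t : ℕ} {δ α η : ℝ}
  {P : Measure Ω} {h : ℕ → Ω → Round 𝓐 𝓑}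

lemma pastAndActions_le (run : IsEXP3UCBRun G T δ α η P h) (ht : t ∈ Set.Icc 1 T) :
    pastAndActions h t ≤ mΩ := by
  have hround := run.measurable t ht
  refine sup_le (iSup₂_le fun τ hτ => ?_) (Measurable.comap_le ?_)
  · exact (run.measurable τ ⟨hτ.1, hτ.2.le.trans ht.2⟩).comap_le
  · exact (measurable_actL.comp hround).prodMk (measurable_actF.comp hround)

lemma past_le (run : IsEXP3UCBRun G T δ α η P h) (ht : t ∈ Set.Icc 1 T) : past h t ≤ mΩ :=
  le_sup_left.trans (run.pastAndActions_le ht)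

lemma measurable_rewards (run : IsEXP3UCBRun G T δ α η P h) (ht : t ∈ Set.Icc 1 T) :
    Measurable fun ω => (rewL (h t ω), rewF (h t ω)) :=
  measurable_snd.comp (measurable_snd.comp (run.measurable t ht))

variable [IsProbabilityMeasure P]

lemma ae_rewards_mem_unit (run : IsEXP3UCBRun G T δ α η P h) (ht : t ∈ Set.Icc 1 T) :
    ∀ᵐ ω ∂P, rewL (h t ω) ∈ Set.Icc (0 : ℝ) 1 ∧ rewF (h t ω) ∈ Set.Icc (0 : ℝ) 1 := by
  set U : Set (ℝ × ℝ) := (Set.Icc 0 1 ×ˢ Set.Icc 0 1)ᶜ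
  have hUmeas : MeasurableSet U := (measurableSet_Icc.prod measurableSet_Icc).compl
  have hUnull : ∀ a b, (G.reward a b).real U = 0 := fun a b => by
    have := G.isProbabilityMeasure a b
    exact (measureReal_eq_zero_iff (by finiteness)).2 (ae_iff.1 (G.mem_unit a b))
  have hpre : MeasurableSet {ω | (rewL (h t ω), rewF (h t ω)) ∈ U} :=
    run.measurable_rewards ht hUmeas
  have hzero : P.real {ω | (rewL (h t ω), rewF (h t ω)) ∈ U} = 0 := by
    rw [← integral_indicator_one hpre]
    refine (integral_condExp (run.pastAndActions_le ht)).symm.trans ?_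
    refine (integral_congr_ae (run.rewards t ht U hUmeas)).trans ?_
    simp [hUnull]
  exact ae_iff.2 ((measureReal_eq_zero_iff (by finiteness)).1 hzero)

lemma map_restrict_rewards (run : IsEXP3UCBRun G T δ α η P h) (ht : t ∈ Set.Icc 1 T) {a : 𝓐}
    {b : 𝓑} {s : Set Ω} (hs : MeasurableSet[pastAndActions h t] s)
    (hsub : ∀ ω ∈ s, actL (h t ω) = a ∧ actF (h t ω) = b) :
    (P.restrict s).map (fun ω => (rewL (h t ω), rewF (h t ω))) = P s • G.reward a b := by
  have := G.isProbabilityMeasure a b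
  have hle := run.pastAndActions_le ht
  have hr := run.measurable_rewards ht
  ext u hu
  set V := {ω | (rewL (h t ω), rewF (h t ω)) ∈ u}
  have hVmeas : MeasurableSet V := hr hu
  rw [Measure.map_apply hr hu, Measure.restrict_apply (hr hu), Measure.smul_apply, smul_eq_mul]
  have hreal : P.real (V ∩ s) = P.real s * (G.reward a b).real u := by
    rw [← measureReal_restrict_apply hVmeas, ← integral_indicator_one hVmeas]
    refine (setIntegral_condExp hle ((integrable_const (1 : ℝ)).indicator hVmeas) hs).symm.trans ?_
    rw [setIntegral_congr_ae (g := fun _ => (G.reward a b).real u) (hle s hs), setIntegral_const,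
      smul_eq_mul]
    filter_upwards [run.rewards t ht u hu] with ω hω hωs
    rw [hω, (hsub ω hωs).1, (hsub ω hωs).2]
  simp only [measureReal_def, ← ENNReal.toReal_mul] at hreal
  exact (ENNReal.toReal_eq_toReal_iff' (by finiteness) (by finiteness)).1 hreal

variable [DiscreteMeasurableSpace 𝓐] [DiscreteMeasurableSpace 𝓑] [Countable 𝓑]

lemma condExp_comp_round (run : IsEXP3UCBRun G T δ α η P h) (ht : t ∈ Set.Icc 1 T)
    {f : Round 𝓐 𝓑 → ℝ} (hf : Measurable f) (hint : Integrable (fun ω => f (h t ω)) P) :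
    P[fun ω => f (h t ω) | pastAndActions h t] =ᵐ[P] fun ω =>
      ∫ r, f (actL (h t ω), actF (h t ω), r) ∂(G.reward (actL (h t ω)) (actF (h t ω))) := by
  have hle := run.pastAndActions_le ht
  have hr := run.measurable_rewards ht
  have honPair : ∀ a b, ∀ᵐ ω ∂P, actL (h t ω) = a ∧ actF (h t ω) = b →
      (P[fun ω => f (h t ω) | pastAndActions h t]) ω = ∫ r, f (a, b, r) ∂(G.reward a b) := by
    intro a b
    set D := {ω | actL (h t ω) = a ∧ actF (h t ω) = b}
    have hDmeas : MeasurableSet[pastAndActions h t] D := measurableSet_actions_eq h t a b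
    have hcond : D.indicator (fun _ => ∫ r, f (a, b, r) ∂(G.reward a b))
        =ᵐ[P] P[D.indicator fun ω => f (h t ω) | pastAndActions h t] := by
      refine ae_eq_condExp_of_forall_setIntegral_eq hle (hint.indicator (hle _ hDmeas))
        (fun s _ _ => ((integrable_const _).indicator (hle _ hDmeas)).integrableOn) ?_
        (stronglyMeasurable_const.indicator hDmeas).aestronglyMeasurable
      intro s hs _
      have hlaw := run.map_restrict_rewards ht (hs.inter hDmeas) fun ω hω => hω.2
      have hfab : Measurable fun r : ℝ × ℝ => f (a, b, r) := by fun_prop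
      rw [setIntegral_indicator (hle _ hDmeas), setIntegral_indicator (hle _ hDmeas),
        setIntegral_const, setIntegral_congr_fun (hle _ (hs.inter hDmeas))
          (g := fun ω => f (a, b, rewL (h t ω), rewF (h t ω))),
        ← integral_map (f := fun r => f (a, b, r)) hr.aemeasurable hfab.aestronglyMeasurable,
        hlaw, integral_smul_measure, measureReal_def]
      rintro ω ⟨-, rfl, rfl⟩
      rfl
    filter_upwards [hcond, condExp_indicator hint hDmeas] with ω hω hind hωD
    rw [Set.indicator_of_mem (show ω ∈ D from hωD)] at hω hind
    rw [← hind, ← hω]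
  filter_upwards [ae_all_iff.2 fun a => ae_all_iff.2 (honPair a)] with ω hω
  exact hω _ _ ⟨rfl, rfl⟩

end IsEXP3UCBRun

end Conditioning

section Leader

variable {𝓐 𝓑 Ω : Type*} [DecidableEq 𝓐] [DecidableEq 𝓑]

/-- The leader's reward of the round `q`, counted only if the leader played `a`, and replaced by its
mean under the best response `br a` if the follower responded wrongly. Its conditional mean then
does not depend on the follower's behaviour. -/
def correctedReward (G : Game 𝓐 𝓑) (br : 𝓐 → 𝓑) (a : 𝓐) (q : Round 𝓐 𝓑) : ℝ :=
  if actL q = a then (if actF q = br a then rewL q else G.meanL a (br a)) else 0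

/-- The importance-weighted estimate, from round `t` of the play `q`, of the leader's mean reward of
`a` under the best response. It is unbiased, and agrees with the estimate that EXP3 uses in every
round in which the follower plays its best response. -/
def estimate [Fintype 𝓐] (G : Game 𝓐 𝓑) (br : 𝓐 → 𝓑) (α η : ℝ) (q : ℕ → Round 𝓐 𝓑) (t : ℕ)
    (a : 𝓐) : ℝ :=
  correctedReward G br a (q t) / exp3 α η q t a

variable {G : Game 𝓐 𝓑} {br : 𝓐 → 𝓑} {a a' : 𝓐}

lemma correctedReward_mem_unit {q : Round 𝓐 𝓑} (hq : rewL q ∈ Set.Icc (0 : ℝ) 1) :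
    correctedReward G br a q ∈ Set.Icc (0 : ℝ) 1 := by
  unfold correctedReward
  split_ifs
  · exact hq
  · exact G.meanL_mem_unit a (br a)
  · exact ⟨le_rfl, zero_le_one⟩

lemma integral_correctedReward (a₀ : 𝓐) (b₀ : 𝓑) :
    ∫ r, correctedReward G br a (a₀, b₀, r) ∂(G.reward a₀ b₀)
      = if a₀ = a then G.meanL a (br a) else 0 := by
  have := G.isProbabilityMeasure a₀ b₀
  change ∫ r, (if a₀ = a then (if b₀ = br a then r.1 else G.meanL a (br a)) else 0)
    ∂(G.reward a₀ b₀) = _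
  split_ifs with ha hb
  · rw [ha, hb, Game.meanL]
  · rw [integral_const, probReal_univ, one_smul]
  · exact integral_zero _ _

lemma estimate_mem_Icc [Fintype 𝓐] [Nonempty 𝓐] {α η : ℝ} (hα₀ : 0 < α) (hα : α ≤ 1)
    {q : ℕ → Round 𝓐 𝓑} {t : ℕ} (hq : rewL (q t) ∈ Set.Icc (0 : ℝ) 1) :
    estimate G br α η q t a ∈ Set.Icc 0 (Fintype.card 𝓐 / α) := by
  obtain ⟨h0, h1⟩ := correctedReward_mem_unit (G := G) (br := br) (a := a) hq
  have hpos : 0 < exp3 α η q t a := mixed_pos hα₀ hα _ a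
  refine ⟨div_nonneg h0 hpos.le, ?_⟩
  calc estimate G br α η q t a ≤ 1 / exp3 α η q t a := by
        unfold estimate
        gcongr
    _ ≤ Fintype.card 𝓐 / α := by
        rw [one_div]
        exact inv_mixed_le hα₀ hα _ a

variable [MeasurableSpace 𝓐] [DiscreteMeasurableSpace 𝓐] [MeasurableSpace 𝓑]
  [DiscreteMeasurableSpace 𝓑]

lemma measurable_correctedReward : Measurable (correctedReward G br a) :=
  Measurable.ite (measurable_actL (measurableSet_singleton a))
    (Measurable.ite (measurable_actF (measurableSet_singleton (br a))) measurable_rewL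
      measurable_const) measurable_const

variable [Fintype 𝓐] {α η : ℝ} {h : ℕ → Ω → Round 𝓐 𝓑} {T t : ℕ}

lemma measurable_estimate [MeasurableSpace Ω] (hh : ∀ τ ∈ Set.Icc 1 t, Measurable (h τ))
    (ht : 1 ≤ t) : Measurable fun ω => estimate G br α η (fun τ => h τ ω) t a := by
  refine (measurable_correctedReward.comp (hh t ⟨ht, le_rfl⟩)).div
    ((measurable_mixed α a).comp (measurable_pi_lambda _ (measurable_score α η fun τ hτ => ?_)))
  exact hh τ ⟨hτ.1, hτ.2.trans (t.sub_le 1)⟩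

namespace IsEXP3UCBRun

variable [mΩ : MeasurableSpace Ω] {P : Measure Ω} [IsProbabilityMeasure P] {δ : ℝ}

lemma integrable_correctedReward (run : IsEXP3UCBRun G T δ α η P h) (ht : t ∈ Set.Icc 1 T) :
    Integrable (fun ω => correctedReward G br a (h t ω)) P :=
  Integrable.of_mem_Icc 0 1 (measurable_correctedReward.comp (run.measurable t ht)).aemeasurable
    ((run.ae_rewards_mem_unit ht).mono fun _ hω => correctedReward_mem_unit hω.1)

variable [Countable 𝓑]

lemma condExp_correctedReward (run : IsEXP3UCBRun G T δ α η P h) (ht : t ∈ Set.Icc 1 T) :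
    P[fun ω => correctedReward G br a (h t ω) | past h t]
      =ᵐ[P] fun ω => G.meanL a (br a) * exp3 α η (fun τ => h τ ω) t a := by
  have hinner : P[fun ω => correctedReward G br a (h t ω) | pastAndActions h t]
      =ᵐ[P] G.meanL a (br a) • {ω | actL (h t ω) = a}.indicator fun _ => (1 : ℝ) := by
    filter_upwards [run.condExp_comp_round ht measurable_correctedReward
      (run.integrable_correctedReward ht)] with ω hω
    rw [hω, integral_correctedReward]
    by_cases ha : actL (h t ω) = a <;> simp [ha]
  filter_upwards [condExp_condExp_of_le (μ := P) (f := fun ω => correctedReward G br a (h t ω))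
      (le_sup_left : past h t ≤ pastAndActions h t) (run.pastAndActions_le ht),
    condExp_congr_ae (m := past h t) hinner, condExp_smul (μ := P) (G.meanL a (br a))
      ({ω | actL (h t ω) = a}.indicator fun _ => (1 : ℝ)) (past h t), run.leader t ht a]
    with ω htower hcongr hsmul hleader
  rw [← htower, hcongr, hsmul, Pi.smul_apply, hleader, smul_eq_mul]

variable [Nonempty 𝓐]

lemma condExp_estimate (run : IsEXP3UCBRun G T δ α η P h) (hα₀ : 0 < α) (hα : α ≤ 1)
    (ht : t ∈ Set.Icc 1 T) :
    P[fun ω => estimate G br α η (fun τ => h τ ω) t a | past h t]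
      =ᵐ[P] fun _ => G.meanL a (br a) := by
  have hinv : Measurable[past h t] fun ω => (exp3 α η (fun τ => h τ ω) t a)⁻¹ := by
    let := past h t
    exact (measurable_exp3 h α η ht.1 a).inv
  have hprod : (fun ω => estimate G br α η (fun τ => h τ ω) t a)
      = (fun ω => (exp3 α η (fun τ => h τ ω) t a)⁻¹) * fun ω => correctedReward G br a (h t ω) := by
    funext ω
    exact div_eq_inv_mul _ _
  have hint : Integrable (fun ω => estimate G br α η (fun τ => h τ ω) t a) P :=
    Integrable.of_mem_Icc 0 (Fintype.card 𝓐 / α)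
      (measurable_estimate (fun τ hτ => run.measurable τ ⟨hτ.1, hτ.2.trans ht.2⟩)
        ht.1).aemeasurable
      ((run.ae_rewards_mem_unit ht).mono fun _ hω => estimate_mem_Icc hα₀ hα hω.1)
  rw [hprod] at hint ⊢
  filter_upwards [condExp_mul_of_stronglyMeasurable_left hinv.stronglyMeasurable hint
    (run.integrable_correctedReward ht), run.condExp_correctedReward ht] with ω hpull hmean
  have hpos : 0 < exp3 α η (fun τ => h τ ω) t a := mixed_pos hα₀ hα _ a
  rw [hpull, Pi.mul_apply, hmean, mul_comm, mul_inv_cancel_right₀ hpos.ne']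

lemma measureReal_le_sum_estimate_sub_le (run : IsEXP3UCBRun G T δ α η P h) (hα₀ : 0 < α)
    (hα : α ≤ 1) (hT : 1 ≤ T) {l : ℝ} (hl : 0 < l) (hlA : l * (Fintype.card 𝓐 / α) ≤ 1) (L : ℝ) :
    P.real {ω | (G.meanL a (br a) - G.meanL a' (br a')) * (T - 1)
          + (l * (3 / 2 * (Fintype.card 𝓐 / α) * T) + L / l)
        ≤ ∑ t ∈ Finset.Ico 1 T, (estimate G br α η (fun τ => h τ ω) t a
          - estimate G br α η (fun τ => h τ ω) t a')} ≤ Real.exp (-L) := by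
  set R : ℝ := Fintype.card 𝓐 / α
  have hIcc : ∀ t ∈ Finset.Ico 1 T, t ∈ Set.Icc 1 T := fun t ht =>
    ⟨(Finset.mem_Ico.1 ht).1, (Finset.mem_Ico.1 ht).2.le⟩
  have hWmeas : ∀ a, ∀ t ∈ Finset.Ico 1 T,
      AEMeasurable (fun ω => estimate G br α η (fun τ => h τ ω) t a) P := fun a t ht =>
    (measurable_estimate (fun τ hτ => run.measurable τ ⟨hτ.1, hτ.2.trans (hIcc t ht).2⟩)
      (hIcc t ht).1).aemeasurable
  have hWpast : ∀ a, ∀ t ∈ Finset.Ico 1 T, ∀ s ∈ Finset.Ico 1 t,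
      Measurable[past h t] fun ω => estimate G br α η (fun τ => h τ ω) s a := fun a t _ s hs => by
    let := past h t
    exact measurable_estimate (fun τ hτ => measurable_past
      ⟨hτ.1, hτ.2.trans_lt (Finset.mem_Ico.1 hs).2⟩) (Finset.mem_Ico.1 hs).1
  have hWR : ∀ a, ∀ t ∈ Finset.Ico 1 T,
      ∀ᵐ ω ∂P, estimate G br α η (fun τ => h τ ω) t a ∈ Set.Icc 0 R := fun a t ht =>
    (run.ae_rewards_mem_unit (hIcc t ht)).mono fun ω hω => estimate_mem_Icc hα₀ hα hω.1
  have hWmean : ∀ a, ∀ t ∈ Finset.Ico 1 T,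
      P[fun ω => estimate G br α η (fun τ => h τ ω) t a | past h t]
        =ᵐ[P] fun _ => G.meanL a (br a) := fun a t ht => run.condExp_estimate hα₀ hα (hIcc t ht)
  refine (measureReal_mono fun ω hω => ?_).trans
    (measureReal_le_sum_sub_le_exp_neg (fun t ht => run.past_le (hIcc t ht)) (hWpast a) (hWpast a')
      (hWmeas a) (hWmeas a') (hWR a) (hWR a') (hWmean a) (hWmean a') hl hlA L)
  obtain ⟨hx₀, hx₁⟩ := G.meanL_mem_unit a (br a)
  obtain ⟨hy₀, hy₁⟩ := G.meanL_mem_unit a' (br a')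
  refine le_trans ?_ (Set.mem_ofPred_eq ▸ hω)
  have hquad : (T - 1) * (3 / 4 * l * R * (G.meanL a (br a) + G.meanL a' (br a')))
      ≤ T * (3 / 4 * l * R * 2) := by
    gcongr <;> linarith
  rw [Nat.card_Ico, Nat.cast_sub hT, Nat.cast_one]
  linarith

end IsEXP3UCBRun

end Leader

section Gaps

namespace Game

variable {𝓐 𝓑 : Type*} {G : Game 𝓐 𝓑} {br : 𝓐 → 𝓑} {ase : 𝓐}

lemma IsUniqueBestResponse.meanF_lt (hbr : G.IsUniqueBestResponse br) {a : 𝓐} {b : 𝓑}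
    (hb : b ≠ br a) : G.meanF a b < G.meanF a (br a) := by
  by_contra! hle
  exact hb ((hbr a b).1 fun b' => ((hbr a (br a)).2 rfl b').trans hle)

lemma IsUniqueStackelberg.meanL_lt (hse : G.IsUniqueStackelberg br ase) {a : 𝓐} (ha : a ≠ ase) :
    G.meanL a (br a) < G.meanL ase (br ase) := by
  by_contra! hle
  exact ha ((hse a).1 fun a' => ((hse ase).2 rfl a').trans hle)

variable [Finite 𝓐]

lemma gapL_le {a : 𝓐} (ha : a ≠ ase) :
    G.gapL br ase ≤ G.meanL ase (br ase) - G.meanL a (br a) :=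
  ciInf_le (f := fun a : {a : 𝓐 // a ≠ ase} => G.meanL ase (br ase) - G.meanL a.1 (br a.1))
    (Set.finite_range _).bddBelow ⟨a, ha⟩

lemma gapL_pos [Nontrivial 𝓐] (hse : G.IsUniqueStackelberg br ase) : 0 < G.gapL br ase := by
  have : Nonempty {a : 𝓐 // a ≠ ase} := nonempty_subtype.2 (exists_ne ase)
  obtain ⟨⟨a, ha⟩, hmin⟩ := exists_eq_ciInf_of_finite
    (f := fun a : {a : 𝓐 // a ≠ ase} => G.meanL ase (br ase) - G.meanL a.1 (br a.1))
  exact (sub_pos.2 (hse.meanL_lt ha)).trans_eq hmin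

lemma gapL_le_one [Nontrivial 𝓐] : G.gapL br ase ≤ 1 := by
  obtain ⟨a, ha⟩ := exists_ne ase
  linarith [G.gapL_le (br := br) ha, (G.meanL_mem_unit ase (br ase)).2,
    (G.meanL_mem_unit a (br a)).1]

variable [Finite 𝓑]

lemma gapF_le {a : 𝓐} {b : 𝓑} (hb : b ≠ br a) : G.gapF br ≤ G.meanF a (br a) - G.meanF a b :=
  ciInf_le (f := fun p : {p : 𝓐 × 𝓑 // p.2 ≠ br p.1} =>
    G.meanF p.1.1 (br p.1.1) - G.meanF p.1.1 p.1.2) (Set.finite_range _).bddBelow ⟨(a, b), hb⟩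

variable [Nonempty 𝓐] [Nontrivial 𝓑]

lemma gapF_pos (hbr : G.IsUniqueBestResponse br) : 0 < G.gapF br := by
  obtain ⟨a⟩ := ‹Nonempty 𝓐›
  obtain ⟨b, hb⟩ := exists_ne (br a)
  have : Nonempty {p : 𝓐 × 𝓑 // p.2 ≠ br p.1} := ⟨⟨(a, b), hb⟩⟩
  obtain ⟨⟨p, hp⟩, hmin⟩ := exists_eq_ciInf_of_finite (f := fun p : {p : 𝓐 × 𝓑 // p.2 ≠ br p.1} =>
    G.meanF p.1.1 (br p.1.1) - G.meanF p.1.1 p.1.2)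
  exact (sub_pos.2 (hbr.meanF_lt hp)).trans_eq hmin

lemma gapF_le_one : G.gapF br ≤ 1 := by
  obtain ⟨a⟩ := ‹Nonempty 𝓐›
  obtain ⟨b, hb⟩ := exists_ne (br a)
  linarith [G.gapF_le hb, (G.meanF_mem_unit a (br a)).2, (G.meanF_mem_unit a b).1]

end Game

end Gaps

section UpperConfidenceBounds

variable {𝓐 𝓑 : Type*} [DecidableEq 𝓐] [DecidableEq 𝓑]

/-- How often `(a,b)` was played in rounds `1, …, t-1` (the `visits` of the follower's bounds,
without the truncation at `1`). -/
def plays (q : ℕ → Round 𝓐 𝓑) (t : ℕ) (a : 𝓐) (b : 𝓑) : ℕ :=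
  ((Finset.Ico 1 t).filter fun τ => actL (q τ) = a ∧ actF (q τ) = b).card

/-- How often the leader played `a` and the follower did not best-respond, in rounds
`1, …, t-1`. -/
def wrongPlays (br : 𝓐 → 𝓑) (q : ℕ → Round 𝓐 𝓑) (t : ℕ) (a : 𝓐) : ℕ :=
  ((Finset.Ico 1 t).filter fun τ => actL (q τ) = a ∧ actF (q τ) ≠ br a).card

/-- The follower's centred cumulative reward from `(a,b)` in rounds `1, …, t-1`. -/
def devF (G : Game 𝓐 𝓑) (q : ℕ → Round 𝓐 𝓑) (t : ℕ) (a : 𝓐) (b : 𝓑) : ℝ :=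
  ∑ τ ∈ Finset.Ico 1 t, if actL (q τ) = a ∧ actF (q τ) = b then rewF (q τ) - G.meanF a b else 0

/-- All empirical means of the follower are within the UCB confidence width, up to time `T`. Both
sides are multiplied by the number of plays, which may be `0`. -/
def Concentrated (G : Game 𝓐 𝓑) (T : ℕ) (δ : ℝ) (q : ℕ → Round 𝓐 𝓑) : Prop :=
  ∀ t ∈ Set.Icc 1 T, ∀ a b, |devF G q t a b| ≤ √(2 * Real.log (T / δ) * plays q t a b)

lemma visits_eq_max (q : ℕ → Round 𝓐 𝓑) (t : ℕ) (a : 𝓐) (b : 𝓑) :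
    visits q t a b = max 1 (plays q t a b : ℝ) := by
  rw [visits, Finset.sum_boole, plays]

lemma plays_succ (q : ℕ → Round 𝓐 𝓑) {t : ℕ} (ht : 1 ≤ t) (a : 𝓐) (b : 𝓑) :
    plays q (t + 1) a b = plays q t a b + if actL (q t) = a ∧ actF (q t) = b then 1 else 0 := by
  simp only [plays, Finset.card_filter, Finset.sum_Ico_succ_top ht]

lemma plays_le_time (q : ℕ → Round 𝓐 𝓑) (t : ℕ) (a : 𝓐) (b : 𝓑) : plays q t a b ≤ t :=
  (Finset.card_filter_le _ _).trans ((Nat.card_Ico 1 t).trans_le (t.sub_le 1))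

lemma wrongPlays_eq_sum [Fintype 𝓑] (br : 𝓐 → 𝓑) (q : ℕ → Round 𝓐 𝓑) (t : ℕ) (a : 𝓐) :
    wrongPlays br q t a = ∑ b ∈ Finset.univ.erase (br a), plays q t a b := by
  rw [wrongPlays, Finset.card_eq_sum_card_fiberwise (f := fun τ => actF (q τ))
    (t := Finset.univ.erase (br a)) fun τ hτ => by simpa using (Finset.mem_filter.1 hτ).2.2]
  refine Finset.sum_congr rfl fun b hb => congrArg Finset.card ?_
  ext τ
  have hbr := Finset.ne_of_mem_erase hb
  simp only [Finset.mem_filter]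
  exact ⟨fun ⟨⟨hτ, haL, _⟩, haF⟩ => ⟨hτ, haL, haF⟩,
    fun ⟨hτ, haL, haF⟩ => ⟨⟨hτ, haL, haF ▸ hbr⟩, haF⟩⟩

variable {G : Game 𝓐 𝓑} {T : ℕ} {δ : ℝ} {q : ℕ → Round 𝓐 𝓑} {t : ℕ} {a : 𝓐} {b : 𝓑}

lemma devF_eq_zero (hn : plays q t a b = 0) : devF G q t a b = 0 := by
  rw [plays, Finset.card_eq_zero, Finset.filter_eq_empty_iff] at hn
  exact Finset.sum_eq_zero fun τ hτ => if_neg (hn hτ)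

lemma empF_eq_zero (hn : plays q t a b = 0) : empF q t a b = 0 := by
  rw [plays, Finset.card_eq_zero, Finset.filter_eq_empty_iff] at hn
  rw [empF, Finset.sum_eq_zero fun τ hτ => if_neg (hn hτ), mul_zero]

lemma visits_eq_plays (hn : 0 < plays q t a b) : visits q t a b = plays q t a b := by
  rw [visits_eq_max, max_eq_right]
  exact_mod_cast hn

lemma empF_sub_meanF (hn : 0 < plays q t a b) :
    empF q t a b - G.meanF a b = devF G q t a b / plays q t a b := by
  have hdev : devF G q t a b = (∑ τ ∈ Finset.Ico 1 t,
      if actL (q τ) = a ∧ actF (q τ) = b then rewF (q τ) else 0)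
        - plays q t a b * G.meanF a b := by
    rw [devF, plays, ← Finset.sum_filter, ← Finset.sum_filter, Finset.sum_sub_distrib,
      Finset.sum_const, nsmul_eq_mul]
  rw [empF, visits_eq_plays hn, hdev]
  field_simp

namespace Concentrated

lemma abs_empF_sub_le (hq : Concentrated G T δ q) (ht : t ∈ Set.Icc 1 T)
    (hn : 0 < plays q t a b) :
    |empF q t a b - G.meanF a b| ≤ √(2 * Real.log (T / δ) / visits q t a b) := by
  have hn' : (0 : ℝ) < plays q t a b := by exact_mod_cast hn
  rw [empF_sub_meanF hn, visits_eq_plays hn, abs_div, abs_of_pos hn', div_le_iff₀ hn']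
  refine (hq t ht a b).trans_eq ?_
  nth_rewrite 3 [← Real.sqrt_sq hn'.le]
  rw [← Real.sqrt_mul' _ (sq_nonneg _)]
  congr 1
  field_simp

lemma meanF_le_ucbF (hq : Concentrated G T δ q) (hl : 1 ≤ Real.log (T / δ))
    (ht : t ∈ Set.Icc 1 T) (a : 𝓐) (b : 𝓑) : G.meanF a b ≤ ucbF T δ q t a b := by
  rcases Nat.eq_zero_or_pos (plays q t a b) with hn | hn
  · rw [ucbF, empF_eq_zero hn, visits_eq_max, hn, Nat.cast_zero, max_eq_left zero_le_one, div_one,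
      zero_add]
    exact (G.meanF_mem_unit a b).2.trans (Real.one_le_sqrt.2 (by linarith))
  · rw [ucbF]
    linarith [(abs_le.1 (hq.abs_empF_sub_le ht hn)).1]

variable [Finite 𝓐] {br : 𝓐 → 𝓑}

lemma plays_le_of_actF_ne [Finite 𝓑] (hq : Concentrated G T δ q) (hgap : 0 < G.gapF br)
    (hl : 1 ≤ Real.log (T / δ)) (ht : t ∈ Set.Icc 1 T)
    (hucb : ucbF T δ q t (actL (q t)) (br (actL (q t)))
      ≤ ucbF T δ q t (actL (q t)) (actF (q t)))
    (hwrong : actF (q t) ≠ br (actL (q t))) :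
    plays q t (actL (q t)) (actF (q t)) ≤ 8 * Real.log (T / δ) / G.gapF br ^ 2 := by
  set a := actL (q t)
  set b := actF (q t)
  rcases Nat.eq_zero_or_pos (plays q t a b) with hn | hn
  · rw [hn, Nat.cast_zero]
    positivity
  have hn' : (0 : ℝ) < plays q t a b := by exact_mod_cast hn
  have hwidth : G.gapF br ≤ 2 * √(2 * Real.log (T / δ) / plays q t a b) := by
    have hbest := (hq.meanF_le_ucbF hl ht a (br a)).trans hucb
    have hplayed := (abs_le.1 (hq.abs_empF_sub_le ht hn)).2
    rw [ucbF] at hbest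
    rw [visits_eq_plays hn] at hbest hplayed
    linarith [G.gapF_le hwrong]
  have hsq := pow_le_pow_left₀ hgap.le hwidth 2
  rw [mul_pow, Real.sq_sqrt (by positivity), ← mul_div_assoc, le_div_iff₀ hn'] at hsq
  rw [le_div_iff₀ (by positivity)]
  linarith

lemma plays_le [Finite 𝓑] (hq : Concentrated G T δ q) (hgap : 0 < G.gapF br)
    (hl : 1 ≤ Real.log (T / δ))
    (hucb : ∀ t ∈ Set.Icc 1 T, ∀ b,
      ucbF T δ q t (actL (q t)) b ≤ ucbF T δ q t (actL (q t)) (actF (q t)))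
    (hb : b ≠ br a) (ht : t ∈ Set.Icc 1 T) :
    plays q t a b ≤ 8 * Real.log (T / δ) / G.gapF br ^ 2 + 1 := by
  obtain ⟨ht₁, htT⟩ := ht
  induction t, ht₁ using Nat.le_induction with
  | base =>
    rw [plays, Finset.Ico_self, Finset.filter_empty, Finset.card_empty, Nat.cast_zero]
    positivity
  | succ t ht₁ ih =>
    have ht : t ∈ Set.Icc 1 T := ⟨ht₁, by omega⟩
    rw [plays_succ q ht₁, Nat.cast_add]
    split_ifs with hab
    · obtain ⟨rfl, rfl⟩ := hab
      simpa using hq.plays_le_of_actF_ne hgap hl ht (hucb t ht _) hb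
    · simpa using ih ht.2

lemma wrongPlays_le [Fintype 𝓑] (hq : Concentrated G T δ q) (hgap : 0 < G.gapF br)
    (hl : 1 ≤ Real.log (T / δ))
    (hucb : ∀ t ∈ Set.Icc 1 T, ∀ b,
      ucbF T δ q t (actL (q t)) b ≤ ucbF T δ q t (actL (q t)) (actF (q t)))
    (ht : t ∈ Set.Icc 1 T) (a : 𝓐) :
    wrongPlays br q t a ≤ Fintype.card 𝓑 * (8 * Real.log (T / δ) / G.gapF br ^ 2 + 1) := by
  rw [wrongPlays_eq_sum, Nat.cast_sum]
  calc ∑ b ∈ Finset.univ.erase (br a), (plays q t a b : ℝ)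
      ≤ ∑ _b ∈ Finset.univ.erase (br a), (8 * Real.log (T / δ) / G.gapF br ^ 2 + 1) :=
        Finset.sum_le_sum fun b hb =>
          hq.plays_le hgap hl hucb (Finset.ne_of_mem_erase hb) ht
    _ ≤ Fintype.card 𝓑 * (8 * Real.log (T / δ) / G.gapF br ^ 2 + 1) := by
        rw [Finset.sum_const, nsmul_eq_mul]
        gcongr
        exact Finset.card_le_univ _

end Concentrated

end UpperConfidenceBounds

section Concentration

variable {𝓐 𝓑 Ω : Type*}

lemma Game.integral_exp_mul_sub_meanF_le (G : Game 𝓐 𝓑) (a : 𝓐) (b : 𝓑) (l : ℝ) :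
    ∫ r, Real.exp (l * (r.2 - G.meanF a b)) ∂(G.reward a b) ≤ Real.exp (l ^ 2 / 8) := by
  have := G.isProbabilityMeasure a b
  have hmgf := (hasSubgaussianMGF_of_mem_Icc (μ := G.reward a b) measurable_snd.aemeasurable
    ((G.mem_unit a b).mono fun r hr => hr.2)).mgf_le l
  refine hmgf.trans_eq (congrArg Real.exp ?_)
  simp only [sub_zero, nnnorm_one, NNReal.coe_pow, NNReal.coe_div, NNReal.coe_one,
    NNReal.coe_ofNat]
  ring

variable [DecidableEq 𝓐] [DecidableEq 𝓑]

/-- The increment, in the round `q`, of the logarithm of the exponential supermartingale with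
parameter `l` that controls `devF` for the action pair `(a,b)`. -/
def tiltedReward (G : Game 𝓐 𝓑) (a : 𝓐) (b : 𝓑) (l : ℝ) (q : Round 𝓐 𝓑) : ℝ :=
  if actL q = a ∧ actF q = b then l * (rewF q - G.meanF a b) - l ^ 2 / 8 else 0

variable {G : Game 𝓐 𝓑} {a : 𝓐} {b : 𝓑}

lemma exists_lt_abs_devF_of_not_concentrated {T : ℕ} {δ : ℝ} {q : ℕ → Round 𝓐 𝓑}
    (hq : ¬ Concentrated G T δ q) :
    ∃ t ∈ Set.Icc 1 T, ∃ a b, plays q t a b ∈ Set.Icc 1 T ∧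
      √(2 * Real.log (T / δ) * plays q t a b) < |devF G q t a b| := by
  obtain ⟨t, ht, a, b, hdev⟩ : ∃ t ∈ Set.Icc 1 T, ∃ a b,
      √(2 * Real.log (T / δ) * plays q t a b) < |devF G q t a b| := by
    simpa only [Concentrated, not_forall, exists_prop, not_le] using hq
  refine ⟨t, ht, a, b, ⟨Nat.one_le_iff_ne_zero.2 fun hn => ?_,
    (plays_le_time q t a b).trans ht.2⟩, hdev⟩
  rw [devF_eq_zero hn, abs_zero] at hdev
  exact hdev.not_ge (Real.sqrt_nonneg _)

lemma sum_tiltedReward (l : ℝ) (q : ℕ → Round 𝓐 𝓑) (t : ℕ) :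
    ∑ τ ∈ Finset.Ico 1 t, tiltedReward G a b l (q τ)
      = l * devF G q t a b - l ^ 2 / 8 * plays q t a b := by
  simp only [tiltedReward, devF, plays, ← Finset.sum_filter, Finset.sum_sub_distrib,
    ← Finset.mul_sum, Finset.sum_const, nsmul_eq_mul]
  ring

lemma abs_tiltedReward_le (l : ℝ) {q : Round 𝓐 𝓑} (hq : rewF q ∈ Set.Icc (0 : ℝ) 1) :
    |tiltedReward G a b l q| ≤ |l| + l ^ 2 / 8 := by
  obtain ⟨hm₀, hm₁⟩ := G.meanF_mem_unit a b
  unfold tiltedReward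
  split_ifs
  · calc |l * (rewF q - G.meanF a b) - l ^ 2 / 8|
        ≤ |l * (rewF q - G.meanF a b)| + |l ^ 2 / 8| := abs_sub _ _
      _ = |l| * |rewF q - G.meanF a b| + l ^ 2 / 8 := by
        rw [abs_mul, abs_of_nonneg (by positivity : 0 ≤ l ^ 2 / 8)]
      _ ≤ |l| * 1 + l ^ 2 / 8 := by
        gcongr
        exact abs_sub_le_of_nonneg_of_le hq.1 hq.2 hm₀ hm₁
      _ = |l| + l ^ 2 / 8 := by rw [mul_one]
  · rw [abs_zero]
    positivity

lemma integral_exp_tiltedReward_le (l : ℝ) (a₀ : 𝓐) (b₀ : 𝓑) :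
    ∫ r, Real.exp (tiltedReward G a b l (a₀, b₀, r)) ∂(G.reward a₀ b₀) ≤ 1 := by
  have := G.isProbabilityMeasure a₀ b₀
  change ∫ r, Real.exp (if a₀ = a ∧ b₀ = b then l * (r.2 - G.meanF a b) - l ^ 2 / 8 else 0)
    ∂(G.reward a₀ b₀) ≤ 1
  split_ifs with hab
  · obtain ⟨rfl, rfl⟩ := hab
    simp only [Real.exp_sub]
    rw [integral_div, div_le_one (Real.exp_pos _)]
    exact G.integral_exp_mul_sub_meanF_le a₀ b₀ l
  · simp

variable [MeasurableSpace 𝓐] [DiscreteMeasurableSpace 𝓐] [MeasurableSpace 𝓑]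
  [DiscreteMeasurableSpace 𝓑]

lemma measurable_tiltedReward (l : ℝ) : Measurable (tiltedReward G a b l) :=
  Measurable.ite ((measurable_actL (measurableSet_singleton a)).inter
      (measurable_actF (measurableSet_singleton b)))
    (((measurable_rewF.sub_const _).const_mul l).sub_const _) measurable_const

namespace IsEXP3UCBRun

variable [Fintype 𝓐] [mΩ : MeasurableSpace Ω] {P : Measure Ω} [IsProbabilityMeasure P]
  {T t : ℕ} {δ α η : ℝ} {h : ℕ → Ω → Round 𝓐 𝓑}

lemma condExp_exp_tiltedReward_le_one [Countable 𝓑] (run : IsEXP3UCBRun G T δ α η P h)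
    (ht : t ∈ Set.Icc 1 T) (l : ℝ) :
    P[fun ω => Real.exp (tiltedReward G a b l (h t ω)) | pastAndActions h t] ≤ᵐ[P] 1 := by
  have hmeas : Measurable fun q => Real.exp (tiltedReward G a b l q) :=
    (measurable_tiltedReward l).exp
  have hint : Integrable (fun ω => Real.exp (tiltedReward G a b l (h t ω))) P := by
    refine Integrable.of_bound (hmeas.comp (run.measurable t ht)).aestronglyMeasurable
      (Real.exp (|l| + l ^ 2 / 8)) ((run.ae_rewards_mem_unit ht).mono fun ω hω => ?_)
    rw [Real.norm_eq_abs, Real.abs_exp, Real.exp_le_exp]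
    exact (le_abs_self _).trans (abs_tiltedReward_le l hω.2)
  filter_upwards [run.condExp_comp_round ht hmeas hint] with ω hω
  rw [hω]
  exact integral_exp_tiltedReward_le l _ _

lemma measureReal_le_mul_devF_sub_le [Countable 𝓑] (run : IsEXP3UCBRun G T δ α η P h)
    (ht : t ∈ Set.Icc 1 T) (l u : ℝ) :
    P.real {ω | u ≤ l * devF G (fun τ => h τ ω) t a b
      - l ^ 2 / 8 * plays (fun τ => h τ ω) t a b} ≤ Real.exp (-u) := by
  have hIcc : ∀ τ ∈ Finset.Ico 1 t, τ ∈ Set.Icc 1 T := fun τ hτ =>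
    ⟨(Finset.mem_Ico.1 hτ).1, (Finset.mem_Ico.1 hτ).2.le.trans ht.2⟩
  simp only [← sum_tiltedReward]
  refine measureReal_le_sum_le_exp_neg (𝓕 := pastAndActions h) (C := |l| + l ^ 2 / 8)
    (X := fun τ ω => tiltedReward G a b l (h τ ω))
    (fun τ hτ => run.pastAndActions_le (hIcc τ hτ)) (fun τ _ s hs => ?_)
    (fun τ hτ => ((measurable_tiltedReward l).comp (run.measurable τ (hIcc τ hτ))).aemeasurable)
    (fun τ hτ => (run.ae_rewards_mem_unit (hIcc τ hτ)).mono fun ω hω =>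
      abs_tiltedReward_le l hω.2)
    (fun τ hτ => run.condExp_exp_tiltedReward_le_one (hIcc τ hτ) l) u
  exact ((measurable_tiltedReward l).comp (measurable_past (Finset.mem_Ico.1 hs))).mono
    le_sup_left le_rfl

lemma measureReal_plays_eq_and_le_abs_devF_le [Countable 𝓑] (run : IsEXP3UCBRun G T δ α η P h)
    (ht : t ∈ Set.Icc 1 T) {n : ℕ} (hn : 0 < n) {s : ℝ} (hs : 0 ≤ s) :
    P.real {ω | plays (fun τ => h τ ω) t a b = n ∧ s ≤ |devF G (fun τ => h τ ω) t a b|}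
      ≤ 2 * Real.exp (-(2 * s ^ 2 / n)) := by
  let tail (l : ℝ) : Set Ω := {ω | 2 * s ^ 2 / n ≤ l * devF G (fun τ => h τ ω) t a b
    - l ^ 2 / 8 * plays (fun τ => h τ ω) t a b}
  have hoptimal : 2 * s ^ 2 / n = 4 * s / n * s - (4 * s / n) ^ 2 / 8 * n := by
    field_simp
    ring
  calc _ ≤ P.real (tail (4 * s / n) ∪ tail (-(4 * s / n))) := by
        refine measureReal_mono fun ω hω => ?_
        obtain ⟨hplays, hdev⟩ := Set.mem_ofPred_eq ▸ hω
        refine (le_abs.1 hdev).imp (fun hpos => ?_) fun hneg => ?_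
        · rw [Set.mem_ofPred_eq, hplays, hoptimal]
          gcongr
        · rw [Set.mem_ofPred_eq, hplays, hoptimal, neg_sq, neg_mul_comm]
          gcongr
    _ ≤ P.real (tail (4 * s / n)) + P.real (tail (-(4 * s / n))) := measureReal_union_le _ _
    _ ≤ Real.exp (-(2 * s ^ 2 / n)) + Real.exp (-(2 * s ^ 2 / n)) :=
        add_le_add (run.measureReal_le_mul_devF_sub_le ht _ _)
          (run.measureReal_le_mul_devF_sub_le ht _ _)
    _ = 2 * Real.exp (-(2 * s ^ 2 / n)) := (two_mul _).symm

lemma measureReal_not_concentrated_le [Fintype 𝓑] (run : IsEXP3UCBRun G T δ α η P h)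
    (hl : 0 ≤ Real.log (T / δ)) :
    P.real {ω | ¬ Concentrated G T δ fun τ => h τ ω}
      ≤ 2 * Fintype.card 𝓐 * Fintype.card 𝓑
        * (T ^ 2 * Real.exp (-(4 * Real.log (T / δ)))) := by
  set l := Real.log (T / δ)
  let I : Finset ((ℕ × ℕ) × 𝓐 × 𝓑) := (Finset.Icc 1 T ×ˢ Finset.Icc 1 T) ×ˢ Finset.univ
  let E (i : (ℕ × ℕ) × 𝓐 × 𝓑) : Set Ω := {ω | plays (fun τ => h τ ω) i.1.1 i.2.1 i.2.2 = i.1.2 ∧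
    √(2 * l * i.1.2) ≤ |devF G (fun τ => h τ ω) i.1.1 i.2.1 i.2.2|}
  have hcover : {ω | ¬ Concentrated G T δ fun τ => h τ ω} ⊆ ⋃ i ∈ I, E i := by
    intro ω hω
    obtain ⟨t, ht, a, b, hn, hdev⟩ := exists_lt_abs_devF_of_not_concentrated hω
    exact Set.mem_iUnion₂.2 ⟨((t, plays (fun τ => h τ ω) t a b), a, b), Finset.mem_product.2
      ⟨Finset.mk_mem_product (Finset.mem_Icc.2 ht) (Finset.mem_Icc.2 hn), Finset.mem_univ _⟩,
      rfl, hdev.le⟩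
  have hevent : ∀ i ∈ I, P.real (E i) ≤ 2 * Real.exp (-(4 * l)) := by
    rintro ⟨⟨t, n⟩, a, b⟩ hi
    simp only [I, Finset.mem_product, Finset.mem_univ, and_true, Finset.mem_Icc] at hi
    have hn : (n : ℝ) ≠ 0 := by exact_mod_cast (zero_lt_one.trans_le hi.2.1).ne'
    refine (run.measureReal_plays_eq_and_le_abs_devF_le hi.1 hi.2.1
      (Real.sqrt_nonneg _)).trans_eq ?_
    rw [Real.sq_sqrt (by positivity), ← mul_assoc, mul_div_cancel_right₀ _ hn]
    ring_nf
  calc _ ≤ P.real (⋃ i ∈ I, E i) := measureReal_mono hcover (measure_ne_top _ _)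
    _ ≤ ∑ i ∈ I, P.real (E i) := measureReal_biUnion_finset_le _ _
    _ ≤ ∑ _i ∈ I, 2 * Real.exp (-(4 * l)) := Finset.sum_le_sum hevent
    _ = 2 * Fintype.card 𝓐 * Fintype.card 𝓑 * (T ^ 2 * Real.exp (-(4 * l))) := by
        simp only [I, Finset.sum_const, nsmul_eq_mul, Finset.card_product, Nat.card_Icc,
          Finset.card_univ, Fintype.card_prod, Nat.add_sub_cancel, Nat.cast_mul]
        ring

end IsEXP3UCBRun

end Concentration

section Scores

variable {𝓐 𝓑 : Type*} [Fintype 𝓐] [DecidableEq 𝓐] {α η : ℝ} {q : ℕ → Round 𝓐 𝓑}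

lemma score_eq_sum (α η : ℝ) (q : ℕ → Round 𝓐 𝓑) (t : ℕ) (a : 𝓐) :
    score α η q t a = η * ∑ τ ∈ Finset.Ico 1 (t + 1),
      if actL (q τ) = a then rewL (q τ) / exp3 α η q τ a else 0 := by
  induction t with
  | zero => rw [score, Finset.Ico_self, Finset.sum_empty, mul_zero]
  | succ t ih =>
    rw [Finset.sum_Ico_succ_top (Nat.le_add_left 1 t), mul_add, ← ih]
    rfl

variable [Nonempty 𝓐] [DecidableEq 𝓑] {G : Game 𝓐 𝓑} {br : 𝓐 → 𝓑}

lemma abs_sub_estimate_le (hα₀ : 0 < α) (hα : α ≤ 1) {t : ℕ}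
    (hr : rewL (q t) ∈ Set.Icc (0 : ℝ) 1) (a : 𝓐) :
    |(if actL (q t) = a then rewL (q t) / exp3 α η q t a else 0) - estimate G br α η q t a|
      ≤ Fintype.card 𝓐 / α * if actL (q t) = a ∧ actF (q t) ≠ br a then 1 else 0 := by
  unfold estimate correctedReward
  by_cases hL : actL (q t) = a <;> by_cases hF : actF (q t) = br a
  · simp [hL, hF]
  · obtain ⟨hm₀, hm₁⟩ := G.meanL_mem_unit a (br a)
    have hpos : 0 < exp3 α η q t a := mixed_pos hα₀ hα _ a
    simp only [hL, hF, if_true, if_false, ne_eq, not_false_eq_true, and_self, mul_one]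
    rw [← sub_div, abs_div, div_eq_mul_inv, abs_of_pos hpos]
    calc |rewL (q t) - G.meanL a (br a)| * (exp3 α η q t a)⁻¹
        ≤ 1 * (exp3 α η q t a)⁻¹ := by
          gcongr
          exact abs_sub_le_of_nonneg_of_le hr.1 hr.2 hm₀ hm₁
      _ ≤ Fintype.card 𝓐 / α := (one_mul _).trans_le (inv_mixed_le hα₀ hα _ a)
  all_goals simp [hL]

lemma score_sub_score_le (hα₀ : 0 < α) (hα : α ≤ 1) (hη : 0 ≤ η) {T : ℕ} (hT : 1 ≤ T)
    (hr : ∀ t ∈ Set.Icc 1 T, rewL (q t) ∈ Set.Icc (0 : ℝ) 1) (a a' : 𝓐) :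
    score α η q (T - 1) a - score α η q (T - 1) a'
      ≤ η * (∑ t ∈ Finset.Ico 1 T, (estimate G br α η q t a - estimate G br α η q t a')
        + Fintype.card 𝓐 / α * (wrongPlays br q T a + wrongPlays br q T a')) := by
  rw [score_eq_sum, score_eq_sum, ← mul_sub, Nat.sub_add_cancel hT]
  refine mul_le_mul_of_nonneg_left ?_ hη
  rw [wrongPlays, wrongPlays, Finset.card_filter, Finset.card_filter, Nat.cast_sum, Nat.cast_sum,
    ← Finset.sum_add_distrib, ← Finset.sum_sub_distrib, Finset.mul_sum, ← Finset.sum_add_distrib]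
  refine Finset.sum_le_sum fun t ht => ?_
  have hrt := hr t ⟨(Finset.mem_Ico.1 ht).1, (Finset.mem_Ico.1 ht).2.le⟩
  have hover := abs_le.1 (abs_sub_estimate_le (G := G) (br := br) (η := η) hα₀ hα hrt a)
  have hunder := abs_le.1 (abs_sub_estimate_le (G := G) (br := br) (η := η) hα₀ hα hrt a')
  push_cast
  linarith [hover.2, hunder.1]

end Scores

section LastIterate

-- The minimizer of the left-hand side is `l = √(L / V)`, unless the constraint forces `l = 1 / R`.
lemma exists_mul_add_div_le {V L R : ℝ} (hV : 0 < V) (hL : 0 < L) (hR : 0 < R) :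
    ∃ l, 0 < l ∧ l * R ≤ 1 ∧ l * V + L / l ≤ 2 * √(V * L) + 2 * L * R := by
  set s := √(L / V) with hs
  have hs₀ : 0 < s := Real.sqrt_pos.2 (by positivity)
  have hsV : s ^ 2 * V = L := by rw [hs, Real.sq_sqrt (by positivity), div_mul_cancel₀ _ hV.ne']
  rcases le_total (s * R) 1 with hsR | hsR
  · refine ⟨s, hs₀, hsR, ?_⟩
    have hsqrt : √(V * L) = s * V := by
      rw [← hsV, show V * (s ^ 2 * V) = (s * V) ^ 2 by ring, Real.sqrt_sq (by positivity)]
    have hdiv : L / s = s * V := by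
      rw [div_eq_iff hs₀.ne', ← hsV]
      ring
    rw [hsqrt, hdiv]
    linarith [mul_pos hL hR]
  · refine ⟨1 / R, by positivity, (one_div_mul_cancel hR.ne').le, ?_⟩
    have hVL : V ≤ L * R ^ 2 :=
      calc V ≤ V * (s * R) ^ 2 := le_mul_of_one_le_right hV.le (one_le_pow₀ hsR)
        _ = L * R ^ 2 := by
          rw [← hsV]
          ring
    have hfirst : 1 / R * V ≤ L * R := by
      rw [one_div_mul_eq_div, div_le_iff₀ hR]
      linarith
    rw [div_div_eq_mul_div, div_one]
    linarith [Real.sqrt_nonneg (V * L)]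

lemma sq_mul_exp_neg_four_mul_log_div {T δ : ℝ} (hT : 0 < T) (hδ : 0 < δ) :
    T ^ 2 * Real.exp (-(4 * Real.log (T / δ))) = δ ^ 4 / T ^ 2 := by
  have hexponent : -(4 * Real.log (T / δ)) = Real.log ((δ / T) ^ 4) := by
    rw [Real.log_pow, ← inv_div, Real.log_inv]
    push_cast
    ring
  rw [hexponent, Real.exp_log (by positivity)]
  field_simp

variable {𝓐 𝓑 Ω : Type*}

/-- An upper bound for the cumulative reward estimate of a suboptimal action, relative to that of
the Stackelberg action, after `T - 1` rounds, valid with probability about `1 - A exp (-L)`. The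
summands are the drift, the fluctuation of the estimates, and the bias caused by wrong responses of
the follower. -/
def advantageBound [Fintype 𝓐] [Fintype 𝓑] (G : Game 𝓐 𝓑) (br : 𝓐 → 𝓑) (ase : 𝓐)
    (T : ℕ) (δ α L : ℝ) : ℝ :=
  -(G.gapL br ase) * (T - 1)
    + (2 * √(3 / 2 * (Fintype.card 𝓐 / α) * T * L) + 2 * L * (Fintype.card 𝓐 / α))
    + Fintype.card 𝓐 / α * (2 * (Fintype.card 𝓑 * (8 * Real.log (T / δ) / G.gapF br ^ 2 + 1)))

variable [Fintype 𝓐] [DecidableEq 𝓐] [DecidableEq 𝓑] {G : Game 𝓐 𝓑} {br : 𝓐 → 𝓑} {ase : 𝓐}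
  {T : ℕ} {δ α η : ℝ}

lemma one_sub_exp3_le [Fintype 𝓑] [Nonempty 𝓐] {q : ℕ → Round 𝓐 𝓑} {L : ℝ}
    (hq : Concentrated G T δ q) (hgap : 0 < G.gapF br) (hα₀ : 0 < α) (hα : α ≤ 1) (hη : 0 ≤ η)
    (hT : 1 ≤ T) (hl : 1 ≤ Real.log (T / δ))
    (hr : ∀ t ∈ Set.Icc 1 T, rewL (q t) ∈ Set.Icc (0 : ℝ) 1)
    (hucb : ∀ t ∈ Set.Icc 1 T, ∀ b,
      ucbF T δ q t (actL (q t)) b ≤ ucbF T δ q t (actL (q t)) (actF (q t)))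
    (hest : ∀ a, a ≠ ase →
      ∑ t ∈ Finset.Ico 1 T, (estimate G br α η q t a - estimate G br α η q t ase)
        ≤ -(G.gapL br ase) * (T - 1)
          + (2 * √(3 / 2 * (Fintype.card 𝓐 / α) * T * L) + 2 * L * (Fintype.card 𝓐 / α))) :
    1 - exp3 α η q T ase
      ≤ α + Fintype.card 𝓐 * Real.exp (η * advantageBound G br ase T δ α L) := by
  refine one_sub_mixed_le hα₀.le _ ase fun a ha => ?_
  refine (score_sub_score_le (G := G) (br := br) hα₀ hα hη hT hr a ase).trans ?_
  unfold advantageBound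
  rw [two_mul (Fintype.card 𝓑 * _ : ℝ)]
  gcongr
  · exact hest a ha
  · exact hq.wrongPlays_le hgap hl hucb ⟨hT, le_rfl⟩ a
  · exact hq.wrongPlays_le hgap hl hucb ⟨hT, le_rfl⟩ ase

namespace IsEXP3UCBRun

variable [MeasurableSpace 𝓐] [DiscreteMeasurableSpace 𝓐] [MeasurableSpace 𝓑]
  [mΩ : MeasurableSpace Ω] {P : Measure Ω} [IsProbabilityMeasure P] {h : ℕ → Ω → Round 𝓐 𝓑}

lemma condExp_actL_ne (run : IsEXP3UCBRun G T δ α η P h) (hT : 1 ≤ T) (a : 𝓐) :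
    P⟦{ω | actL (h T ω) ≠ a} | past h T⟧ =ᵐ[P] fun ω => 1 - exp3 α η (fun τ => h τ ω) T a := by
  have hT' : T ∈ Set.Icc 1 T := ⟨hT, le_rfl⟩
  have hmeas : MeasurableSet {ω | actL (h T ω) = a} :=
    (measurable_actL.comp (run.measurable T hT')) (measurableSet_singleton a)
  have hcompl : {ω | actL (h T ω) ≠ a}.indicator (fun _ => (1 : ℝ))
      = (fun _ => 1) - {ω | actL (h T ω) = a}.indicator fun _ => (1 : ℝ) :=
    Set.indicator_compl _ _
  rw [hcompl]
  filter_upwards [condExp_sub (integrable_const (1 : ℝ))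
    ((integrable_const (1 : ℝ)).indicator hmeas) (past h T), run.leader T hT' a]
    with ω hsub hleader
  rw [hsub, Pi.sub_apply, hleader, condExp_const (run.past_le hT')]

lemma measureReal_lt_condExp_actL_ne_eq_zero (run : IsEXP3UCBRun G T δ α η P h) (hT : 1 ≤ T)
    (hα₀ : 0 < α) (hα : α ≤ 1) (a : 𝓐) {c : ℝ} (hc : 1 ≤ c) :
    P.real {ω | c < (P⟦{ω' | actL (h T ω') ≠ a} | past h T⟧) ω} = 0 := by
  rw [measureReal_eq_zero_iff]
  refine measure_eq_zero_iff_ae_notMem.2 ?_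
  filter_upwards [run.condExp_actL_ne hT a] with ω hω hlt
  have : Nonempty 𝓐 := ⟨a⟩
  have hpos : 0 < exp3 α η (fun τ => h τ ω) T a := mixed_pos hα₀ hα _ a
  rw [hω] at hlt
  linarith

variable [DiscreteMeasurableSpace 𝓑]

lemma measureReal_lt_sum_estimate_sub_le [Countable 𝓑] (run : IsEXP3UCBRun G T δ α η P h)
    (hα₀ : 0 < α) (hα : α ≤ 1) (hT : 1 ≤ T) {L : ℝ} (hL : 0 < L) {a : 𝓐} (ha : a ≠ ase) :
    P.real {ω | -(G.gapL br ase) * (T - 1)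
          + (2 * √(3 / 2 * (Fintype.card 𝓐 / α) * T * L) + 2 * L * (Fintype.card 𝓐 / α))
        < ∑ t ∈ Finset.Ico 1 T, (estimate G br α η (fun τ => h τ ω) t a
          - estimate G br α η (fun τ => h τ ω) t ase)} ≤ Real.exp (-L) := by
  have : Nonempty 𝓐 := ⟨a⟩
  have hR : 0 < Fintype.card 𝓐 / α := div_pos (Nat.cast_pos.2 Fintype.card_pos) hα₀
  have hT' : (1 : ℝ) ≤ T := by exact_mod_cast hT
  obtain ⟨l, hl, hlR, hbound⟩ := exists_mul_add_div_le
    (V := 3 / 2 * (Fintype.card 𝓐 / α) * T) (by positivity) hL hR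
  refine (measureReal_mono fun ω hω => ?_).trans
    (run.measureReal_le_sum_estimate_sub_le hα₀ hα hT hl hlR L (br := br) (a := a) (a' := ase))
  refine le_trans ?_ (Set.mem_ofPred_eq ▸ hω).le
  gcongr
  linarith [G.gapL_le (br := br) ha]

lemma measureReal_lt_condExp_actL_ne_le [Fintype 𝓑] [Nonempty 𝓐] (run : IsEXP3UCBRun G T δ α η P h)
    (hgap : 0 < G.gapF br) (hα₀ : 0 < α) (hα : α ≤ 1) (hη : 0 ≤ η) (hT : 1 ≤ T) (hδ : 0 < δ)
    (hl : 1 ≤ Real.log (T / δ)) {L : ℝ} (hL : 0 < L) :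
    P.real {ω | α + Fintype.card 𝓐 * Real.exp (η * advantageBound G br ase T δ α L)
        < (P⟦{ω' | actL (h T ω') ≠ ase} | past h T⟧) ω}
      ≤ Fintype.card 𝓐 * Real.exp (-L)
        + 2 * Fintype.card 𝓐 * Fintype.card 𝓑 * (δ ^ 4 / T ^ 2) := by
  set D : ℝ := 2 * √(3 / 2 * (Fintype.card 𝓐 / α) * T * L) + 2 * L * (Fintype.card 𝓐 / α)
  let E (a : 𝓐) : Set Ω := {ω | -(G.gapL br ase) * (T - 1) + D
    < ∑ t ∈ Finset.Ico 1 T, (estimate G br α η (fun τ => h τ ω) t a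
      - estimate G br α η (fun τ => h τ ω) t ase)}
  let F : Set Ω := {ω | ¬ Concentrated G T δ fun τ => h τ ω}
  have hcover : ({ω | α + Fintype.card 𝓐 * Real.exp (η * advantageBound G br ase T δ α L)
      < (P⟦{ω' | actL (h T ω') ≠ ase} | past h T⟧) ω} : Set Ω)
        ≤ᵐ[P] ((⋃ a ∈ Finset.univ.erase ase, E a) ∪ F : Set Ω) := by
    filter_upwards [run.condExp_actL_ne hT ase,
      (ae_ball_iff (Set.to_countable _)).2 fun t ht => run.ae_rewards_mem_unit ht,
      (ae_ball_iff (Set.to_countable _)).2 run.follower] with ω hcond hunit hucb hbad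
    by_contra hgood
    obtain ⟨hE, hF⟩ := not_or.1 hgood
    refine hbad.not_ge (hcond.trans_le (one_sub_exp3_le (not_not.1 hF) hgap hα₀ hα hη hT hl
      (fun t ht => (hunit t ht).1) hucb fun a ha => ?_))
    exact not_lt.1 fun hlt => hE (Set.mem_iUnion₂.2 ⟨a, by simpa using ha, hlt⟩)
  have hE : P.real (⋃ a ∈ Finset.univ.erase ase, E a) ≤ Fintype.card 𝓐 * Real.exp (-L) :=
    calc _ ≤ ∑ a ∈ Finset.univ.erase ase, P.real (E a) := measureReal_biUnion_finset_le _ _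
      _ ≤ ∑ _a ∈ Finset.univ.erase ase, Real.exp (-L) := Finset.sum_le_sum fun a ha =>
          run.measureReal_lt_sum_estimate_sub_le hα₀ hα hT hL (Finset.ne_of_mem_erase ha)
      _ ≤ Fintype.card 𝓐 * Real.exp (-L) := by
          rw [Finset.sum_const, nsmul_eq_mul]
          gcongr
          exact Finset.card_le_univ _
  have hF : P.real F ≤ 2 * Fintype.card 𝓐 * Fintype.card 𝓑 * (δ ^ 4 / T ^ 2) := by
    rw [← sq_mul_exp_neg_four_mul_log_div (by exact_mod_cast hT) hδ]
    exact run.measureReal_not_concentrated_le (zero_le_one.trans hl)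
  exact (ENNReal.toReal_mono (measure_ne_top _ _) (measure_mono_ae hcover)).trans
    ((measureReal_union_le _ _).trans (add_le_add hE hF))

end IsEXP3UCBRun

end LastIterate

section HighProbability

lemma rpow_third_pow_three {t : ℝ} (ht : 0 ≤ t) : (t ^ (1 / 3 : ℝ)) ^ 3 = t := by
  rw [← Real.rpow_natCast, ← Real.rpow_mul ht]
  norm_num

lemma rpow_third_sq {t : ℝ} (ht : 0 ≤ t) : (t ^ (1 / 3 : ℝ)) ^ 2 = t ^ (2 / 3 : ℝ) := by
  rw [← Real.rpow_natCast, ← Real.rpow_mul ht]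
  norm_num

lemma mul_rpow_neg_third_mul_le {t a b c : ℝ} (ht : 0 < t) (hc : 0 ≤ c)
    (hab : a ≤ t ^ (1 / 3 : ℝ) * b) : c * t ^ (-(1 / 3) : ℝ) * a ≤ c * b :=
  calc c * t ^ (-(1 / 3) : ℝ) * a ≤ c * t ^ (-(1 / 3) : ℝ) * (t ^ (1 / 3 : ℝ) * b) := by gcongr
    _ = c * b := by
        rw [Real.rpow_neg ht.le]
        field_simp

lemma one_le_log_one_div {δ : ℝ} (hδ₀ : 0 < δ) (hδ : δ ≤ 1 / 3) : 1 ≤ Real.log (1 / δ) := by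
  rw [Real.le_log_iff_exp_le (by positivity)]
  exact Real.exp_one_lt_three.le.trans ((le_one_div (by norm_num) hδ₀).2 hδ)

lemma log_two_div {δ : ℝ} (hδ : 0 < δ) :
    Real.log (2 / δ) = Real.log 2 + Real.log (1 / δ) := by
  rw [← Real.log_mul two_ne_zero (by positivity), mul_one_div]

lemma log_one_div_le_log_div {T δ : ℝ} (hT : 1 ≤ T) (hδ : 0 < δ) :
    Real.log (1 / δ) ≤ Real.log (T / δ) :=
  Real.log_le_log (by positivity) (by gcongr)

section RealInequalities

variable {A B g l D : ℝ}

lemma mul_le_mul_div_sq_mul_mul (hA : 0 ≤ A) (hB : 1 ≤ B) (hg₀ : 0 < g) (hg : g ≤ 1) (hl : 1 ≤ l)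
    (hD : 0 ≤ D) : A * D ≤ A * B / g ^ 2 * l * D := by
  have hAB : A ≤ A * B / g ^ 2 :=
    (le_mul_of_one_le_right hA hB).trans
      (le_div_self (by positivity) (by positivity) (pow_le_one₀ hg₀.le hg))
  have hABl : A ≤ A * B / g ^ 2 * l := hAB.trans (le_mul_of_one_le_right (hA.trans hAB) hl)
  gcongr

lemma mul_two_mul_mul_add_one_le (hA : 0 ≤ A) (hB : 0 ≤ B) (hg₀ : 0 < g) (hg : g ≤ 1) (hl : 1 ≤ l)
    (hD : 1 ≤ D) : A * (2 * (B * (8 * l / g ^ 2 + 1))) ≤ 18 * (A * B / g ^ 2 * l * D) := by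
  have hl₀ : 0 ≤ l := zero_le_one.trans hl
  have hone : 1 ≤ l / g ^ 2 :=
    hl.trans (le_div_self hl₀ (by positivity) (pow_le_one₀ hg₀.le hg))
  calc A * (2 * (B * (8 * l / g ^ 2 + 1)))
      ≤ A * (2 * (B * (8 * l / g ^ 2 + l / g ^ 2))) := by gcongr
    _ = 18 * (A * B / g ^ 2 * l) := by ring
    _ ≤ 18 * (A * B / g ^ 2 * l * D) :=
        mul_le_mul_of_nonneg_left (le_mul_of_one_le_right (by positivity) hD) (by norm_num)

lemma neg_mul_add_add_le {d s S f b Q x : ℝ} (hs : s ≤ S) (hf : f ≤ 16 / 3 * Q) (hb : b ≤ 18 * Q)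
    (hd : d ≤ 1) (hQ : 1 ≤ Q) (hx : 1 ≤ x) :
    -d * (x ^ 3 - 1) + s * x ^ 2 + f * x + b * x ≤ x * (-d * x ^ 2 + S * x + 25 * Q) := by
  have hQx : 1 ≤ Q * x := one_le_mul_of_one_le_of_one_le hQ hx
  calc -d * (x ^ 3 - 1) + s * x ^ 2 + f * x + b * x
      ≤ -d * (x ^ 3 - 1) + S * x ^ 2 + 16 / 3 * Q * x + 18 * Q * x := by gcongr
    _ ≤ x * (-d * x ^ 2 + S * x + 25 * Q) := by linarith

lemma two_mul_mul_mul_pow_four_div_sq_le {T δ : ℝ} (hT : 1 ≤ T) (hAB : A * B ≤ T) (hδ₀ : 0 ≤ δ)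
    (hδ : δ ≤ 1) : 2 * A * B * (δ ^ 4 / T ^ 2) ≤ 2 * δ := by
  have hAB' : A * B ≤ T ^ 2 := hAB.trans (le_self_pow₀ hT two_ne_zero)
  calc 2 * A * B * (δ ^ 4 / T ^ 2) = 2 * (A * B) * (δ ^ 4 / T ^ 2) := by ring
    _ ≤ 2 * T ^ 2 * (δ ^ 4 / T ^ 2) := by gcongr
    _ = 2 * δ ^ 4 := by field_simp
    _ ≤ 2 * δ := by
        gcongr
        exact pow_le_of_le_one hδ₀ hδ four_ne_zero

lemma three_fourths_mul_log_add_log_le {T δ c : ℝ} (hA : 1 ≤ A) (hAT : A ≤ T) (hδ₀ : 0 < δ)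
    (hδ : δ ≤ 1 / 3) (hc : 1 ≤ c) (hcδ : 1 + Real.log A ≤ c ∨ δ ≤ T ^ (-3 : ℝ)) :
    3 / 4 * (Real.log A + Real.log (1 / δ)) ≤ c * Real.log (2 / δ) := by
  have hlogA : 0 ≤ Real.log A := Real.log_nonneg hA
  have hlogδ : 1 ≤ Real.log (1 / δ) := one_le_log_one_div hδ₀ hδ
  have hlog₂ : 0 ≤ Real.log 2 := Real.log_nonneg one_le_two
  rw [log_two_div hδ₀]
  rcases hcδ with hcA | hδT
  · calc 3 / 4 * (Real.log A + Real.log (1 / δ))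
        ≤ (1 + Real.log A) * Real.log (1 / δ) := by
          linarith [le_mul_of_one_le_right hlogA hlogδ]
      _ ≤ (1 + Real.log A) * (Real.log 2 + Real.log (1 / δ)) := by
          gcongr
          exact le_add_of_nonneg_left hlog₂
      _ ≤ c * (Real.log 2 + Real.log (1 / δ)) := by gcongr
  · have hlog : 3 * Real.log A ≤ Real.log (1 / δ) := by
      have hT : 0 < T := by linarith
      have hlogT := Real.log_le_log hδ₀ hδT
      rw [Real.log_rpow hT] at hlogT
      rw [one_div, Real.log_inv]
      linarith [Real.log_le_log (by linarith) hAT]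
    calc 3 / 4 * (Real.log A + Real.log (1 / δ)) ≤ 1 * (Real.log 2 + Real.log (1 / δ)) := by
          linarith
      _ ≤ c * (Real.log 2 + Real.log (1 / δ)) := by gcongr

end RealInequalities

variable {𝓐 𝓑 Ω : Type*} [Fintype 𝓐] [Fintype 𝓑]

lemma advantageBound_eq (G : Game 𝓐 𝓑) (br : 𝓐 → 𝓑) (ase : 𝓐) {T : ℕ} (δ c L : ℝ) {x : ℝ}
    (hx : x ^ 3 = T) :
    advantageBound G br ase T δ (c * x⁻¹) L
      = -(G.gapL br ase) * (x ^ 3 - 1) + 2 * √(3 / 2 * (Fintype.card 𝓐 / c) * L) * x ^ 2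
        + 2 * L * (Fintype.card 𝓐 / c) * x
        + Fintype.card 𝓐 / c * (2 * (Fintype.card 𝓑 * (8 * Real.log (T / δ) / G.gapF br ^ 2 + 1)))
          * x := by
  have hR : Fintype.card 𝓐 / (c * x⁻¹) = Fintype.card 𝓐 / c * x := by
    rw [div_mul_eq_div_div, div_inv_eq_mul]
  have hsqrt : √(3 / 2 * (Fintype.card 𝓐 / c * x) * T * L)
      = √(3 / 2 * (Fintype.card 𝓐 / c) * L) * x ^ 2 := by
    rw [← hx, ← Real.sqrt_sq (sq_nonneg x), ← Real.sqrt_mul' _ (sq_nonneg (x ^ 2))]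
    congr 1
    ring
  rw [advantageBound, hR, hsqrt, ← hx]
  ring

/-- The exponent in the high-probability bound on the last iterate, with the constant `C₁ = 25`. -/
def lastIterateExponent (G : Game 𝓐 𝓑) (br : 𝓐 → 𝓑) (ase : 𝓐) (T : ℕ) (δ : ℝ) : ℝ :=
  -(G.gapL br ase) * (T : ℝ) ^ (2 / 3 : ℝ)
    + 2 * √(2 * Fintype.card 𝓐 * Real.log (2 / δ)) * (T : ℝ) ^ (1 / 3 : ℝ)
    + 25 * Fintype.card 𝓐 * Fintype.card 𝓑 / G.gapF br ^ 2 * Real.log (T / δ) * Real.log (1 / δ)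

variable [Nontrivial 𝓐] [Nontrivial 𝓑] {G : Game 𝓐 𝓑} {br : 𝓐 → 𝓑} {ase : 𝓐} {T : ℕ} {δ : ℝ}

lemma advantageBound_le_mul_lastIterateExponent (hgap : 0 < G.gapF br) (hT : 1 ≤ T) (hδ₀ : 0 < δ)
    (hδ : δ ≤ 1 / 3) {c L : ℝ} (hc : 1 ≤ c) (hL : 3 / 4 * L ≤ c * Real.log (2 / δ)) :
    advantageBound G br ase T δ (c * (T : ℝ) ^ (-(1 / 3) : ℝ)) L
      ≤ (T : ℝ) ^ (1 / 3 : ℝ) * lastIterateExponent G br ase T δ := by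
  have hT' : (1 : ℝ) ≤ T := by exact_mod_cast hT
  have hA : (1 : ℝ) ≤ Fintype.card 𝓐 := Nat.one_le_cast.2 Fintype.card_pos
  have hB : (1 : ℝ) ≤ Fintype.card 𝓑 := Nat.one_le_cast.2 Fintype.card_pos
  have hD : 1 ≤ Real.log (1 / δ) := one_le_log_one_div hδ₀ hδ
  have hl : 1 ≤ Real.log (T / δ) := hD.trans (log_one_div_le_log_div hT' hδ₀)
  have hx : ((T : ℝ) ^ (1 / 3 : ℝ)) ^ 3 = T := rpow_third_pow_three T.cast_nonneg
  have hx₁ : 1 ≤ (T : ℝ) ^ (1 / 3 : ℝ) := Real.one_le_rpow hT' (by norm_num)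
  rw [lastIterateExponent, ← rpow_third_sq T.cast_nonneg, Real.rpow_neg T.cast_nonneg,
    advantageBound_eq G br ase δ c L hx]
  set x : ℝ := (T : ℝ) ^ (1 / 3 : ℝ)
  set A := (Fintype.card 𝓐 : ℝ)
  set B := (Fintype.card 𝓑 : ℝ)
  set Q := A * B / G.gapF br ^ 2 * Real.log (T / δ) * Real.log (1 / δ) with hQ
  have hAQ : A * Real.log (1 / δ) ≤ Q :=
    mul_le_mul_div_sq_mul_mul (by linarith) hB hgap G.gapF_le_one hl (by linarith)
  have hQ₁ : 1 ≤ Q := (one_le_mul_of_one_le_of_one_le hA hD).trans hAQ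
  have hAL : A / c * L ≤ 4 / 3 * (A * Real.log (2 / δ)) := by
    rw [div_mul_eq_mul_div, div_le_iff₀ (by linarith)]
    linarith [mul_le_mul_of_nonneg_left hL (zero_le_one.trans hA)]
  have hsqrt : √(3 / 2 * (A / c) * L) ≤ √(2 * A * Real.log (2 / δ)) :=
    Real.sqrt_le_sqrt (by linarith)
  have hfluct : 2 * L * (A / c) ≤ 16 / 3 * Q := by
    have hlog : A * Real.log (2 / δ) ≤ A * (2 * Real.log (1 / δ)) := by
      gcongr
      linarith [log_two_div hδ₀, Real.log_two_lt_d9]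
    linarith
  have hbias : A / c * (2 * (B * (8 * Real.log (T / δ) / G.gapF br ^ 2 + 1))) ≤ 18 * Q :=
    (mul_le_mul_of_nonneg_right (div_le_self (by linarith) hc) (by positivity)).trans
      (mul_two_mul_mul_add_one_le (by linarith) (by linarith) hgap G.gapF_le_one hl hD)
  refine (neg_mul_add_add_le
    (mul_le_mul_of_nonneg_left hsqrt zero_le_two) hfluct hbias G.gapL_le_one hQ₁ hx₁).trans_eq ?_
  rw [hQ]
  ring

lemma mul_advantageBound_le_lastIterateExponent (hgap : 0 < G.gapF br) (hT : 1 ≤ T) (hδ₀ : 0 < δ)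
    (hδ : δ ≤ 1 / 3) {c c' L : ℝ} (hc : 1 ≤ c) (hc' : 1 ≤ c')
    (hL : 3 / 4 * L ≤ c * Real.log (2 / δ)) (hneg : lastIterateExponent G br ase T δ < 0) :
    c' * (T : ℝ) ^ (-(1 / 3) : ℝ) * advantageBound G br ase T δ (c * (T : ℝ) ^ (-(1 / 3) : ℝ)) L
      ≤ lastIterateExponent G br ase T δ :=
  (mul_rpow_neg_third_mul_le (Nat.cast_pos.2 hT) (zero_le_one.trans hc')
    (advantageBound_le_mul_lastIterateExponent hgap hT hδ₀ hδ hc hL)).trans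
    (mul_le_of_one_le_left hneg.le hc')

lemma card_mul_card_le_of_lastIterateExponent_neg (hgap : 0 < G.gapF br) (hT : 1 ≤ T)
    (hδ₀ : 0 < δ) (hδ : δ ≤ 1 / 3) (hneg : lastIterateExponent G br ase T δ < 0) :
    (Fintype.card 𝓐 : ℝ) * Fintype.card 𝓑 ≤ T := by
  have hT' : (1 : ℝ) ≤ T := by exact_mod_cast hT
  have hD : 1 ≤ Real.log (1 / δ) := one_le_log_one_div hδ₀ hδ
  have hl : 1 ≤ Real.log (T / δ) := hD.trans (log_one_div_le_log_div hT' hδ₀)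
  have hdrift : G.gapL br ase * (T : ℝ) ^ (2 / 3 : ℝ) ≤ 1 * T :=
    mul_le_mul G.gapL_le_one (Real.rpow_le_self_of_one_le hT' (by norm_num)) (by positivity)
      zero_le_one
  have hcard := mul_le_mul_div_sq_mul_mul (A := (Fintype.card 𝓐 * Fintype.card 𝓑 : ℝ))
    (by positivity) le_rfl hgap G.gapF_le_one hl (zero_le_one.trans hD)
  have hfluct : 0 ≤ 2 * √(2 * Fintype.card 𝓐 * Real.log (2 / δ)) * (T : ℝ) ^ (1 / 3 : ℝ) := by
    positivity
  unfold lastIterateExponent at hneg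
  have hcardD : (Fintype.card 𝓐 * Fintype.card 𝓑 : ℝ)
      ≤ Fintype.card 𝓐 * Fintype.card 𝓑 * Real.log (1 / δ) :=
    le_mul_of_one_le_right (by positivity) hD
  rw [mul_one] at hcard
  rw [mul_assoc 25, mul_div_assoc] at hneg
  linarith

lemma one_sub_measureReal_lt_le [MeasurableSpace Ω] {P : Measure Ω} [IsProbabilityMeasure P]
    (f : Ω → ℝ) (c : ℝ) : 1 - P.real {ω | c < f ω} ≤ P.real {ω | f ω ≤ c} := by
  have hcover : {ω | f ω ≤ c} ∪ {ω | c < f ω} = Set.univ :=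
    Set.eq_univ_of_forall fun ω => le_or_gt (f ω) c
  have hunion := measureReal_union_le (μ := P) {ω | f ω ≤ c} {ω | c < f ω}
  rw [hcover, probReal_univ] at hunion
  linarith

namespace IsEXP3UCBRun

variable [DecidableEq 𝓐] [MeasurableSpace 𝓐] [DiscreteMeasurableSpace 𝓐]
  [DecidableEq 𝓑] [MeasurableSpace 𝓑] [DiscreteMeasurableSpace 𝓑]
  [mΩ : MeasurableSpace Ω] {P : Measure Ω} [IsProbabilityMeasure P] {h : ℕ → Ω → Round 𝓐 𝓑}
  {cα cη : ℝ}

lemma measureReal_lt_condExp_actL_ne_le_of_lastIterateExponent_neg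
    (run : IsEXP3UCBRun G T δ (cα * (T : ℝ) ^ (-(1 / 3) : ℝ)) (cη * (T : ℝ) ^ (-(1 / 3) : ℝ)) P h)
    (hgap : 0 < G.gapF br) (hT : 1 ≤ T) (hδ₀ : 0 < δ) (hδ : δ ≤ 1 / 3)
    (hα : cα * (T : ℝ) ^ (-(1 / 3) : ℝ) ≤ 1) (hcα : 1 ≤ cα) (hcη : 1 ≤ cη)
    (hc : 1 + Real.log (Fintype.card 𝓐) ≤ cα ∨ δ ≤ (T : ℝ) ^ (-3 : ℝ))
    (hneg : lastIterateExponent G br ase T δ < 0) :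
    P.real {ω | cα * (T : ℝ) ^ (-(1 / 3) : ℝ)
        + Fintype.card 𝓐 * Real.exp (lastIterateExponent G br ase T δ)
          < (P⟦{ω' | actL (h T ω') ≠ ase} | past h T⟧) ω} ≤ 3 * δ := by
  have hT' : (1 : ℝ) ≤ T := by exact_mod_cast hT
  have hA : (1 : ℝ) ≤ Fintype.card 𝓐 := Nat.one_le_cast.2 Fintype.card_pos
  have hB : (1 : ℝ) ≤ Fintype.card 𝓑 := Nat.one_le_cast.2 Fintype.card_pos
  have hD : 1 ≤ Real.log (1 / δ) := one_le_log_one_div hδ₀ hδ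
  have hcard := card_mul_card_le_of_lastIterateExponent_neg hgap hT hδ₀ hδ hneg
  set L := Real.log (Fintype.card 𝓐) + Real.log (1 / δ) with hL
  have hL₀ : 0 < L := add_pos_of_nonneg_of_pos (Real.log_nonneg hA) (by linarith)
  have hLδ : 3 / 4 * L ≤ cα * Real.log (2 / δ) :=
    three_fourths_mul_log_add_log_le hA ((le_mul_of_one_le_right (by positivity) hB).trans hcard)
      hδ₀ hδ hcα hc
  have hexp : Fintype.card 𝓐 * Real.exp (-L) = δ := by
    rw [hL, neg_add, Real.exp_add, ← Real.log_inv, ← Real.log_inv, Real.exp_log (by positivity),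
      Real.exp_log (by positivity)]
    field_simp
  have htail : 2 * Fintype.card 𝓐 * Fintype.card 𝓑 * (δ ^ 4 / T ^ 2) ≤ 2 * δ :=
    two_mul_mul_mul_pow_four_div_sq_le hT' hcard hδ₀.le (by linarith)
  calc _ ≤ Fintype.card 𝓐 * Real.exp (-L)
        + 2 * Fintype.card 𝓐 * Fintype.card 𝓑 * (δ ^ 4 / T ^ 2) := by
        refine (measureReal_mono fun ω hω => ?_).trans
          (run.measureReal_lt_condExp_actL_ne_le (ase := ase) hgap (by positivity) hα
            (by positivity) hT hδ₀ (hD.trans (log_one_div_le_log_div hT' hδ₀)) hL₀)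
        refine lt_of_le_of_lt ?_ (Set.mem_ofPred_eq ▸ hω)
        gcongr
        exact mul_advantageBound_le_lastIterateExponent hgap hT hδ₀ hδ hcα hcη hLδ hneg
    _ ≤ 3 * δ := by linarith

lemma one_sub_le_measureReal_condExp_actL_ne_le
    (run : IsEXP3UCBRun G T δ (cα * (T : ℝ) ^ (-(1 / 3) : ℝ)) (cη * (T : ℝ) ^ (-(1 / 3) : ℝ)) P h)
    (hgap : 0 < G.gapF br) (hT : 1 ≤ T) (hδ₀ : 0 < δ)
    (hα : cα * (T : ℝ) ^ (-(1 / 3) : ℝ) ≤ 1) (hcα : 1 ≤ cα) (hcη : 1 ≤ cη)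
    (hc : 1 + Real.log (Fintype.card 𝓐) ≤ cα ∨ δ ≤ (T : ℝ) ^ (-3 : ℝ)) :
    1 - 3 * δ ≤ P.real {ω | (P⟦{ω' | actL (h T ω') ≠ ase} | past h T⟧) ω
      ≤ cα * (T : ℝ) ^ (-(1 / 3) : ℝ)
        + Fintype.card 𝓐 * Real.exp (lastIterateExponent G br ase T δ)} := by
  rcases le_total (1 / 3) δ with hδ | hδ
  · exact le_trans (by linarith) measureReal_nonneg
  refine le_trans (sub_le_sub_left ?_ 1) (one_sub_measureReal_lt_le _ _)
  rcases le_or_gt 0 (lastIterateExponent G br ase T δ) with hexponent | hexponent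
  · have hα₀ : 0 < cα * (T : ℝ) ^ (-(1 / 3) : ℝ) := by positivity
    have hA : (1 : ℝ) ≤ Fintype.card 𝓐 := Nat.one_le_cast.2 Fintype.card_pos
    have htrivial := one_le_mul_of_one_le_of_one_le hA (Real.one_le_exp hexponent)
    rw [run.measureReal_lt_condExp_actL_ne_eq_zero hT hα₀ hα ase (by linarith)]
    positivity
  · exact run.measureReal_lt_condExp_actL_ne_le_of_lastIterateExponent_neg hgap hT hδ₀ hδ hα hcα
      hcη hc hexponent

end IsEXP3UCBRun

end HighProbability

section Convergence

open Filter Topology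

lemma log_div_le_mul_rpow_third {T δ β : ℝ} (hT : 1 ≤ T) (hδ₀ : 0 < δ) (hβ : 0 ≤ β)
    (hδ : T ^ (-β) ≤ δ) : Real.log (T / δ) ≤ 3 * (1 + β) * T ^ (1 / 3 : ℝ) := by
  have hT₀ : 0 < T := by linarith
  have hlogδ : -(β * Real.log T) ≤ Real.log δ := by
    simpa only [Real.log_rpow hT₀, neg_mul] using Real.log_le_log (by positivity) hδ
  calc Real.log (T / δ) = Real.log T - Real.log δ := Real.log_div hT₀.ne' hδ₀.ne'
    _ ≤ (1 + β) * Real.log T := by linarith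
    _ ≤ (1 + β) * (T ^ (1 / 3 : ℝ) / (1 / 3)) := by
        gcongr
        exact Real.log_le_rpow_div hT₀.le (by norm_num)
    _ = 3 * (1 + β) * T ^ (1 / 3 : ℝ) := by ring

lemma pow_four_div_sq_le_one_div_rpow_third {T δ : ℝ} (hT : 1 ≤ T) (hδ₀ : 0 ≤ δ) (hδ : δ ≤ 1) :
    δ ^ 4 / T ^ 2 ≤ 1 / T ^ (1 / 3 : ℝ) := by
  gcongr
  · exact pow_le_one₀ hδ₀ hδ
  · rw [← Real.rpow_natCast]
    exact Real.rpow_le_rpow_of_exponent_le hT (by norm_num)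

variable {𝓐 𝓑 Ω : Type*} [Fintype 𝓐] [Nontrivial 𝓐] [Fintype 𝓑]

lemma exists_advantageBound_le (G : Game 𝓐 𝓑) (br : 𝓐 → 𝓑) (ase : 𝓐) {c β L : ℝ} (hc : 0 < c)
    (hβ : 0 ≤ β) (hL : 0 ≤ L) :
    ∃ K, ∀ (T : ℕ) (δ : ℝ), 1 ≤ T → 0 < δ → (T : ℝ) ^ (-β) ≤ δ →
      advantageBound G br ase T δ (c * (T : ℝ) ^ (-(1 / 3) : ℝ)) L
        ≤ (T : ℝ) ^ (1 / 3 : ℝ)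
          * ((T : ℝ) ^ (1 / 3 : ℝ) * (K - G.gapL br ase * (T : ℝ) ^ (1 / 3 : ℝ))) := by
  refine ⟨1 + 2 * √(3 / 2 * (Fintype.card 𝓐 / c) * L) + 2 * L * (Fintype.card 𝓐 / c)
    + Fintype.card 𝓐 / c * (2 * (Fintype.card 𝓑 * (8 * (3 * (1 + β)) / G.gapF br ^ 2 + 1))),
    fun T δ hT hδ₀ hδ => ?_⟩
  have hT' : (1 : ℝ) ≤ T := by exact_mod_cast hT
  have hlog := log_div_le_mul_rpow_third hT' hδ₀ hβ hδ
  have hx : ((T : ℝ) ^ (1 / 3 : ℝ)) ^ 3 = T := rpow_third_pow_three T.cast_nonneg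
  have hx₁ : 1 ≤ (T : ℝ) ^ (1 / 3 : ℝ) := Real.one_le_rpow hT' (by norm_num)
  rw [Real.rpow_neg T.cast_nonneg, advantageBound_eq G br ase δ c L hx]
  set x : ℝ := (T : ℝ) ^ (1 / 3 : ℝ)
  have hxx : x ≤ x ^ 2 := le_self_pow₀ hx₁ two_ne_zero
  have hdrift : G.gapL br ase ≤ x ^ 2 := G.gapL_le_one.trans (hx₁.trans hxx)
  have hfluct : 2 * L * (Fintype.card 𝓐 / c) * x ≤ 2 * L * (Fintype.card 𝓐 / c) * x ^ 2 := by
    gcongr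
  have hbias :
      Fintype.card 𝓐 / c * (2 * (Fintype.card 𝓑 * (8 * Real.log (T / δ) / G.gapF br ^ 2 + 1))) * x
      ≤ Fintype.card 𝓐 / c * (2 * (Fintype.card 𝓑 * (8 * (3 * (1 + β)) / G.gapF br ^ 2 + 1)))
        * x ^ 2 :=
    calc _ ≤ Fintype.card 𝓐 / c
          * (2 * (Fintype.card 𝓑 * (8 * (3 * (1 + β) * x) / G.gapF br ^ 2 + x))) * x := by gcongr
      _ = _ := by ring
  linarith

lemma tendsto_add_mul_exp_add_div_sq {Δ : ℝ} (hΔ : 0 < Δ) {c' : ℝ} (hc' : 0 < c') (c A K C : ℝ) :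
    Tendsto (fun x : ℝ => c * x⁻¹ + A * Real.exp (c' * (x * (K - Δ * x))) + C / x) atTop
      (𝓝 0) := by
  have hlinear : Tendsto (fun x : ℝ => K - Δ * x) atTop atBot :=
    tendsto_const_nhds.add_atBot (tendsto_neg_atTop_atBot.comp (tendsto_id.const_mul_atTop hΔ))
  have hexp : Tendsto (fun x : ℝ => Real.exp (c' * (x * (K - Δ * x)))) atTop (𝓝 0) :=
    Real.tendsto_exp_atBot.comp ((tendsto_id.atTop_mul_atBot₀ hlinear).const_mul_atBot hc')
  simpa only [mul_zero, add_zero, id_eq] using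
    ((tendsto_inv_atTop_zero.const_mul c).add (hexp.const_mul A)).add
      (tendsto_const_nhds.div_atTop tendsto_id)

variable [DecidableEq 𝓐] [MeasurableSpace 𝓐] [DiscreteMeasurableSpace 𝓐]
  [DecidableEq 𝓑] [MeasurableSpace 𝓑] [DiscreteMeasurableSpace 𝓑]
  {G : Game 𝓐 𝓑} {br : 𝓐 → 𝓑} {ase : 𝓐}

lemma IsEXP3UCBRun.measureReal_actL_ne_le {T : ℕ} {δ α η : ℝ} [mΩ : MeasurableSpace Ω]
    {P : Measure Ω} [IsProbabilityMeasure P] {h : ℕ → Ω → Round 𝓐 𝓑}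
    (run : IsEXP3UCBRun G T δ α η P h) (hgap : 0 < G.gapF br) (hα₀ : 0 < α) (hα : α ≤ 1)
    (hη : 0 ≤ η) (hT : 1 ≤ T) (hδ : 0 < δ) (hl : 1 ≤ Real.log (T / δ)) {L : ℝ} (hL : 0 < L) :
    P.real {ω | actL (h T ω) ≠ ase}
      ≤ α + Fintype.card 𝓐 * Real.exp (η * advantageBound G br ase T δ α L)
        + (Fintype.card 𝓐 * Real.exp (-L)
          + 2 * Fintype.card 𝓐 * Fintype.card 𝓑 * (δ ^ 4 / T ^ 2)) := by
  have hT' : T ∈ Set.Icc 1 T := ⟨hT, le_rfl⟩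
  have hmeas : MeasurableSet {ω | actL (h T ω) ≠ ase} :=
    ((measurable_actL.comp (run.measurable T hT')) (measurableSet_singleton ase)).compl
  exact (measureReal_le_add_measureReal_lt_condExp (run.past_le hT') hmeas (by positivity)).trans
    (add_le_add_right (run.measureReal_lt_condExp_actL_ne_le hgap hα₀ hα hη hT hδ hl hL) _)

variable [Nontrivial 𝓑]

lemma exists_forall_measureReal_actL_ne_le (hbr : G.IsUniqueBestResponse br)
    (hse : G.IsUniqueStackelberg br ase) {cα cη β ε : ℝ} (hcα : 0 < cα) (hcη : 0 < cη)
    (hβ : 0 < β) (hε : 0 < ε) :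
    ∃ T₀ : ℕ, ∀ (T : ℕ) (δ : ℝ), T₀ ≤ T → 0 < δ → δ < 1 → (T : ℝ) ^ (-β) ≤ δ →
      ∀ (Ω : Type*) [MeasurableSpace Ω] (P : Measure Ω) [IsProbabilityMeasure P]
        (h : ℕ → Ω → Round 𝓐 𝓑),
      IsEXP3UCBRun G T δ (cα * (T : ℝ) ^ (-(1 / 3) : ℝ)) (cη * (T : ℝ) ^ (-(1 / 3) : ℝ)) P h →
      P.real {ω | actL (h T ω) ≠ ase} ≤ ε := by
  obtain ⟨L, hLε, hL⟩ := (((Real.tendsto_exp_neg_atTop_nhds_zero.const_mul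
    (Fintype.card 𝓐 : ℝ)).eventually_le_const (by rw [mul_zero]; exact half_pos hε)).and
      (eventually_gt_atTop 0)).exists
  obtain ⟨K, hK⟩ := exists_advantageBound_le G br ase hcα hβ.le hL.le
  have hthird : Tendsto (fun T : ℕ => (T : ℝ) ^ (1 / 3 : ℝ)) atTop atTop :=
    (tendsto_rpow_atTop (by norm_num)).comp tendsto_natCast_atTop_atTop
  have hlim := (tendsto_add_mul_exp_add_div_sq (G.gapL_pos hse) hcη cα (Fintype.card 𝓐) K
    (2 * Fintype.card 𝓐 * Fintype.card 𝓑)).comp hthird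
  have hα : ∀ᶠ T : ℕ in atTop, cα * (T : ℝ) ^ (-(1 / 3) : ℝ) ≤ 1 :=
    (((tendsto_rpow_neg_atTop (by norm_num)).comp tendsto_natCast_atTop_atTop).const_mul
      cα).eventually_le_const (by rw [mul_zero]; exact one_pos)
  obtain ⟨T₀, hT₀⟩ := eventually_atTop.1
    ((hlim.eventually_le_const (half_pos hε)).and (hα.and (eventually_ge_atTop 3)))
  refine ⟨T₀, fun T δ hT hδ₀ hδ₁ hδ Ω _ P _ h run => ?_⟩
  obtain ⟨hsmall, hα₁, hT₃⟩ := hT₀ T hT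
  have hT' : (3 : ℝ) ≤ T := by exact_mod_cast hT₃
  have hl : 1 ≤ Real.log (T / δ) := by
    rw [Real.le_log_iff_exp_le (by positivity)]
    exact Real.exp_one_lt_three.le.trans (hT'.trans (le_div_self (by positivity) hδ₀ hδ₁.le))
  refine (run.measureReal_actL_ne_le (G.gapF_pos hbr) (by positivity) hα₁ (by positivity)
    (by omega) hδ₀ hl hL (ase := ase)).trans ?_
  have hexponent := mul_rpow_neg_third_mul_le (by positivity) hcη.le (hK T δ (by omega) hδ₀ hδ)
  have htail := pow_four_div_sq_le_one_div_rpow_third (T := T) (by linarith) hδ₀.le hδ₁.le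
  calc _ ≤ cα * (T : ℝ) ^ (-(1 / 3) : ℝ) + Fintype.card 𝓐 * Real.exp
          (cη * ((T : ℝ) ^ (1 / 3 : ℝ) * (K - G.gapL br ase * (T : ℝ) ^ (1 / 3 : ℝ))))
        + (ε / 2 + 2 * Fintype.card 𝓐 * Fintype.card 𝓑 * (1 / (T : ℝ) ^ (1 / 3 : ℝ))) := by gcongr
    _ ≤ ε := by
        rw [Function.comp_apply, ← Real.rpow_neg T.cast_nonneg] at hsmall
        linarith [mul_one_div (2 * Fintype.card 𝓐 * Fintype.card 𝓑 : ℝ) ((T : ℝ) ^ (1 / 3 : ℝ))]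

end Convergence

end StackelbergLearning

end

theorem theorem2 :
    (∃ C₁ : ℝ, 0 < C₁ ∧
      ∀ (𝓐 𝓑 : Type*) [Fintype 𝓐] [DecidableEq 𝓐] [Nontrivial 𝓐]
        [MeasurableSpace 𝓐] [DiscreteMeasurableSpace 𝓐]
        [Fintype 𝓑] [DecidableEq 𝓑] [Nontrivial 𝓑]
        [MeasurableSpace 𝓑] [DiscreteMeasurableSpace 𝓑]
        (G : StackelbergLearning.Game 𝓐 𝓑) (br : 𝓐 → 𝓑) (ase : 𝓐),
        G.IsUniqueBestResponse br → G.IsUniqueStackelberg br ase →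
        ∀ (T : ℕ) (δ cα cη α η : ℝ), 1 ≤ T → 0 < δ → δ < 1 →
        1 ≤ cα → 1 ≤ cη →
        (1 + Real.log (Fintype.card 𝓐) ≤ cα ∨ δ ≤ (T : ℝ) ^ (-3 : ℝ)) →
        α = cα * (T : ℝ) ^ (-(1 / 3) : ℝ) → α ≤ 1 →
        η = cη * (T : ℝ) ^ (-(1 / 3) : ℝ) →
        ∀ (Ω : Type*) [MeasurableSpace Ω] (P : MeasureTheory.Measure Ω)
          [MeasureTheory.IsProbabilityMeasure P]
          (h : ℕ → Ω → StackelbergLearning.Round 𝓐 𝓑),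
        StackelbergLearning.IsEXP3UCBRun G T δ α η P h →
        1 - 3 * δ ≤ P.real {ω |
          (P⟦{ω' | StackelbergLearning.actL (h T ω') ≠ ase} | StackelbergLearning.past h T⟧) ω
            ≤ α + Fintype.card 𝓐 * Real.exp (
                -(G.gapL br ase) * (T : ℝ) ^ (2 / 3 : ℝ)
                + 2 * Real.sqrt (2 * Fintype.card 𝓐 * Real.log (2 / δ)) * (T : ℝ) ^ (1 / 3 : ℝ)
                + C₁ * Fintype.card 𝓐 * Fintype.card 𝓑 / (G.gapF br) ^ 2
                    * Real.log (T / δ) * Real.log (1 / δ))})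
    ∧
    (∀ (𝓐 𝓑 : Type*) [Fintype 𝓐] [DecidableEq 𝓐] [Nontrivial 𝓐]
        [MeasurableSpace 𝓐] [DiscreteMeasurableSpace 𝓐]
        [Fintype 𝓑] [DecidableEq 𝓑] [Nontrivial 𝓑]
        [MeasurableSpace 𝓑] [DiscreteMeasurableSpace 𝓑]
        (G : StackelbergLearning.Game 𝓐 𝓑) (br : 𝓐 → 𝓑) (ase : 𝓐),
        G.IsUniqueBestResponse br → G.IsUniqueStackelberg br ase →
        ∀ (cα cη β ε : ℝ), 0 < cα → 0 < cη → 0 < β → 0 < ε →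
        ∃ T₀ : ℕ, ∀ (T : ℕ) (δ : ℝ), T₀ ≤ T → 0 < δ → δ < 1 → (T : ℝ) ^ (-β) ≤ δ →
        ∀ (Ω : Type*) [MeasurableSpace Ω] (P : MeasureTheory.Measure Ω)
          [MeasureTheory.IsProbabilityMeasure P]
          (h : ℕ → Ω → StackelbergLearning.Round 𝓐 𝓑),
        StackelbergLearning.IsEXP3UCBRun G T δ
          (cα * (T : ℝ) ^ (-(1 / 3) : ℝ)) (cη * (T : ℝ) ^ (-(1 / 3) : ℝ)) P h →
        P.real {ω | StackelbergLearning.actL (h T ω) ≠ ase} ≤ ε) := by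
  refine ⟨⟨25, by norm_num, ?_⟩, ?_⟩
  · intro 𝓐 𝓑 _ _ _ _ _ _ _ _ _ _ G br ase hbr _ T δ cα cη α η hT hδ _ hcα hcη hc hα hα₁ hη
      Ω _ P _ h run
    subst hα hη
    exact run.one_sub_le_measureReal_condExp_actL_ne_le (G.gapF_pos hbr) hT hδ hα₁ hcα hcη hc
  · intro 𝓐 𝓑 _ _ _ _ _ _ _ _ _ _ G br ase hbr hse cα cη β ε hcα hcη hβ hε
    exact StackelbergLearning.exists_forall_measureReal_actL_ne_le hbr hse hcα hcη hβ hε
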